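/- **Theorem 6.7.** *Model.* A (deterministic) cell-probe data structure with space $s$, word size $w$ and query time $t$ encodes every database as $s$ cells of $w$ bits each and answers every Boolean query by an adaptive algorithm that, on every database, reads at most $t$ cells; computation is free. A randomized data structure is a probability distribution over deterministic ones (the encoding and the query algorithm share the coins); it solves a problem if, for every database and every query, it gives an acceptable answer with probability at least $2/3$. *Problem.* Let $\varepsilon>0$, and let $L\in\{1,\dots,d\}$ be known in advance. In the decision version of the $(1+\varepsilon)$-approximate nearest neighbor problem in the Hamming cube, the databases are the sets $P\subseteq\{0,1\}^d$ of $n$ points and the queries are the points $q\in\{0,1\}^d$. With $\ell_H$ the Hamming distance, the answer has to be "yes" if $\ell_H(p,q)\le L$ for some $p\in P$, and "no" if $\ell_H(p,q)\ge(1+\varepsilon)L$ for every $p\in P$; otherwise either answer is acceptable. *Claim.* Every (possibly randomized) cell-probe data structure for this problem with query time $t=O(1)$ and word size $w=O(n^{1-\delta})$, $\delta>0$ constant, in dimension $d=\Omega(\varepsilon^{-2}\log n)$, uses space $s=n^{\Omega(\varepsilon^{-2})}$. Precisely: there is an absolute constant $C>0$ such that for every $t\in\mathbb N$ and $\delta>0$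 there is a constant $c=c(t,\delta)>0$ such that for all $\varepsilon>0$ and $K>0$ there is an $N$ such that for every $n\ge N$ and every $d\ge C\max\{1,\varepsilon^{-2}\}\ln n$ there is an $L\in\{1,\dots,d\}$ for which the following holds: every randomized cell-probe data structure with space $s$, word size $w\le K n^{1-\delta}$ and query time at most $t$ that solves the decision version of the $(1+\varepsilon)$-approximate nearest neighbor problem for $n$-point subsets of $\{0,1\}^d$ with parameter $L$ satisfies $$s\ \ge\ n^{c/\varepsilon^2}.$$ -/

import Mathlib

/-- The Hamming cube `{0,1}^d`; the Hamming distance is Mathlib's `hammingDist`. -/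
abbrev Cube (d : ℕ) : Type := Fin d → Bool

/-- The `n`-point subsets of the Hamming cube `{0,1}^d`. -/
abbrev PointSet (d n : ℕ) : Type := {P : Finset (Cube d) // P.card = n}

/-- The contents of one cell: `w` bits. -/
abbrev Word (w : ℕ) : Type := Fin w → Bool

/-- A memory of `s` cells of `w` bits each. -/
abbrev CellMemory (s w : ℕ) : Type := Fin s → Word w

/-- An adaptive Boolean query algorithm for a memory of `s` cells of `w` bits: it either stops with
an answer, or names a cell, is given its contents, and goes on depending on them. -/
inductive QueryAlg (s w : ℕ) : Type
  | answer (b : Bool) : QueryAlg s w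
  | probe (cell : Fin s) (next : Word w → QueryAlg s w) : QueryAlg s w

namespace QueryAlg

/-- The answer that the algorithm gives on the memory `m`. -/
def run {s w : ℕ} : QueryAlg s w → CellMemory s w → Bool
  | answer b, _ => b
  | probe cell next, m => run (next (m cell)) m

/-- The number of cell accesses that the algorithm makes on the memory `m`. -/
def accesses {s w : ℕ} : QueryAlg s w → CellMemory s w → ℕ
  | answer _, _ => 0
  | probe cell next, m => accesses (next (m cell)) m + 1

end QueryAlg

/-- A deterministic cell-probe data structure for databases in `Db` and Boolean queries in `Qy`,
with space `s` (cells), word size `w` (bits) and query time at most `t` (cell accesses). -/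
structure CellProbeScheme (Db Qy : Type) (s w t : ℕ) : Type where
  /-- The encoding of a database. -/
  encode : Db → CellMemory s w
  /-- The algorithm that answers a query. -/
  query : Qy → QueryAlg s w
  /-- Every query on every database takes at most `t` cell accesses. -/
  queryTime_le : ∀ (D : Db) (q : Qy), (query q).accesses (encode D) ≤ t

/-- The answer of a deterministic data structure to the query `q` on the database `D`. -/
def CellProbeScheme.output {Db Qy : Type} {s w t : ℕ} (σ : CellProbeScheme Db Qy s w t)
    (D : Db) (q : Qy) : Bool :=
  (σ.query q).run (σ.encode D)

/-- A randomized cell-probe data structure: a probability distribution over deterministic ones.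
The coins are shared by the encoding and the query algorithm. A deterministic data structure is the
special case of a point mass. -/
abbrev RandCellProbeScheme (Db Qy : Type) (s w t : ℕ) : Type :=
  PMF (CellProbeScheme Db Qy s w t)

/-- A randomized data structure solves a decision problem, given by the relation `ok D q b` (the
answer `b` to the query `q` on the database `D` is acceptable), if for every database and every
query its answer is acceptable with probability at least `2/3` over the coins. -/
def RandCellProbeScheme.Solves {Db Qy : Type} {s w t : ℕ} (R : RandCellProbeScheme Db Qy s w t)
    (ok : Db → Qy → Bool → Prop) : Prop :=
  ∀ (D : Db) (q : Qy), 2 / 3 ≤ R.toOuterMeasure {σ | ok D q (σ.output D q)}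

/-- Acceptable answers in the decision version of the `(1+ε)`-approximate nearest neighbor problem
with distance parameter `L`: "yes" is required if some point of `P` is at Hamming distance at most
`L` from the query, "no" is required if all points of `P` are at Hamming distance at least
`(1+ε)L` from the query, and either answer is accepted if neither is the case. -/
def annAcceptable {d n : ℕ} (ε : ℝ) (L : ℕ) (P : PointSet d n) (q : Cube d) (b : Bool) : Prop :=
  ((∃ p ∈ P.1, hammingDist p q ≤ L) → b = true) ∧
    ((∀ p ∈ P.1, (1 + ε) * (L : ℝ) ≤ (hammingDist p q : ℝ)) → b = false)

/-!
The lower bound is a direct counting argument for lopsided set disjointness, together with a random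
embedding of that problem into the Hamming cube.

*Set disjointness.* A database is a map `τ : Fin n → Fin k × Fin 10` with the `n` elements
`(τ b, b)`, a query is a map `σ : Fin k → Fin n` which asks whether one of the `k` elements
`((i, 0), σ i)` is present, and `k` is of order `1/ε²` (and `k = 1` for large `ε`). A query hits a random database with
probability at most `1/10`. As the error probability of the data structure is at most `1/3` on every
pair, averaging gives a deterministic data structure (`exists_deterministic`) whose answers "no" are
right so often that, if a right one is rewarded with `3/50` and a wrong one costs `1`, the expected
reward is at least a positive constant. The factor `10` is what makes amplification of the success
probability unnecessary.

*Counting.* Fix a database with a reward of at least half of the average. By pigeonhole over the at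
most `(s + 1)^t` sequences of addresses, some transcript `l` (addresses and contents of the cells
read) is shared by a family `rejecting alg l` of at least `Ω(n^k / (s + 1)^t)` queries with the
answer "no", of which the database misses the fraction `50/53` (`exists_transcript`). This family
depends on the transcript alone, and there are at most `(s 2^w + 1)^t` transcripts. On the other
hand, a fixed family of at least `n^(k (1 - O(δ)))` queries is mostly missed by only a
`(993/1000)^R` fraction of the databases, where `R = ⌊n^(1-δ/2)⌋` (`card_mostly_missed_le`). To see
this, take the `R`-th moment of the number of missed queries: among `R` random queries of the family
almost every one has at least `4k/5` elements outside of the union of the others seen so far, hence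
reduces the probability that all are missed by a factor of about `exp (-2/25)`, and
`exp (-2/25) < 50/53`. So the number of transcripts is at least `exp (Ω(n^(1-δ/2)))`
(`le_transcripts_mul_pow`), which is impossible for `w = O(n^(1-δ))` and `s < n^(ck)`.

*Embedding.* Elements are mapped to random points of the cube, a query to the coordinatewise
majority of its elements. The majority of `k` bits agrees with each of them with probability at least
`1/2 + 1/(8√k)` (`le_sum_sign_mul_majority`, from the second and the fourth moment of a sum of
signs), and is independent of all other bits. With `ε ≤ 1/(8√k)` and `d` of order `k log n`, the
elements of a query are therefore at distance at most `L` from it and all others at distance at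
least `(1 + ε) L`, except for few queries (`exists_gap_embedding`).
-/

namespace CellProbeANN

open Finset

/-! ### Lopsided set disjointness -/

/-- The blocks `Fin k`, each with ten variants, of which only variant `0` can be asked for. -/
abbrev Color (k : ℕ) : Type := Fin k × Fin 10

/-- The database `τ` (which contains the elements `(τ b, b)`) contains no element `((i, 0), b)`
with `(i, b) ∈ V`. -/
def Misses {k n : ℕ} (τ : Fin n → Color k) (V : Finset (Fin k × Fin n)) : Prop :=
  ∀ p ∈ V, τ p.2 ≠ (p.1, 0)

instance {k n : ℕ} (τ : Fin n → Color k) : DecidablePred (Misses τ) := fun V =>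
  inferInstanceAs (Decidable (∀ p ∈ V, τ p.2 ≠ (p.1, 0)))

/-- The set asked for by the query `σ`, which names one element of every block. -/
def graph {k n : ℕ} (σ : Fin k → Fin n) : Finset (Fin k × Fin n) :=
  univ.image fun i => (i, σ i)

lemma mem_graph {k n : ℕ} {σ : Fin k → Fin n} {p : Fin k × Fin n} :
    p ∈ graph σ ↔ σ p.1 = p.2 := by
  simp only [graph, mem_image, mem_univ, true_and, Prod.ext_iff]
  constructor
  · rintro ⟨i, rfl, h⟩
    exact h
  · intro h
    exact ⟨p.1, rfl, h⟩

lemma misses_union {k n : ℕ} {τ : Fin n → Color k} {V W : Finset (Fin k × Fin n)} :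
    Misses τ (V ∪ W) ↔ Misses τ V ∧ Misses τ W := by
  simp only [Misses, mem_union, or_imp, forall_and]

lemma misses_graph {k n : ℕ} {τ : Fin n → Color k} {σ : Fin k → Fin n} :
    Misses τ (graph σ) ↔ ∀ i, τ (σ i) ≠ (i, 0) := by
  simp only [Misses, mem_graph, Prod.forall]
  constructor
  · intro h i
    exact h i _ rfl
  · rintro h i b rfl
    exact h i

lemma card_graph {k n : ℕ} (σ : Fin k → Fin n) : #(graph σ) = k := by
  rw [graph, card_image_of_injective _ (fun i j h => (Prod.ext_iff.1 h).1), card_univ,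
    Fintype.card_fin]

/-- The variables `τ b` are independent, so each element of `V` costs a factor `1 - 1/(10k)`. -/
lemma card_misses_le {k n : ℕ} (hk : 0 < k) (V : Finset (Fin k × Fin n)) :
    (#{τ : Fin n → Color k | Misses τ V} : ℝ) ≤
      (10 * k : ℝ) ^ n * Real.exp (-(#V : ℝ) / (10 * k)) := by
  have hk' : (0 : ℝ) < 10 * k := by positivity
  let W : Fin n → Finset (Color k) := fun b => ({i | (i, b) ∈ V} : Finset (Fin k)).map
    ⟨fun i => (i, 0), fun i j h => (Prod.ext_iff.1 h).1⟩
  have hW : ({τ : Fin n → Color k | Misses τ V} : Finset _) = Fintype.piFinset fun b => (W b)ᶜ := by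
    ext τ
    simp only [mem_filter, mem_univ, true_and, Fintype.mem_piFinset, mem_compl, W, mem_map,
      Misses, Prod.forall]
    constructor
    · rintro h b ⟨i, hi, hb⟩
      exact h i b hi hb.symm
    · intro h i b hi hb
      exact h b ⟨i, hi, hb.symm⟩
  have hsum : ∑ b, #(W b) = #V := by
    rw [card_eq_sum_card_fiberwise (f := Prod.snd) (t := univ) (fun _ _ => mem_coe.2 (mem_univ _))]
    refine sum_congr rfl fun b _ => ?_
    rw [card_map]
    refine card_bij (fun i _ => (i, b)) ?_ ?_ ?_
    · intro i hi
      simpa using hi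
    · intro i _ j _ h
      exact (Prod.ext_iff.1 h).1
    · rintro ⟨i, b'⟩ h
      simp only [mem_filter] at h
      obtain ⟨h1, rfl⟩ := h
      exact ⟨i, by simpa using h1, rfl⟩
  rw [hW, Fintype.card_piFinset]
  push_cast
  calc ∏ b, (#((W b)ᶜ) : ℝ)
      ≤ ∏ b, ((10 * k : ℝ) * Real.exp (-(#(W b) : ℝ) / (10 * k))) := by
        refine prod_le_prod (fun _ _ => by positivity) fun b _ => ?_
        have h1 : (#(W b)ᶜ : ℝ) = 10 * k - #(W b) := by
          rw [card_compl, Nat.cast_sub (card_le_univ _)]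
          simp only [Fintype.card_prod, Fintype.card_fin, Nat.cast_mul, Nat.cast_ofNat]
          ring
        have h2 := Real.add_one_le_exp (-(#(W b) : ℝ) / (10 * k))
        calc (#(W b)ᶜ : ℝ) = 10 * k * (-(#(W b) : ℝ) / (10 * k) + 1) := by
              rw [h1]; field_simp; ring
          _ ≤ _ := by gcongr
    _ = (10 * k : ℝ) ^ n * Real.exp (-(#V : ℝ) / (10 * k)) := by
        rw [prod_mul_distrib, prod_const, card_univ, Fintype.card_fin, ← Real.exp_sum, ← sum_div,
          sum_neg_distrib, ← Nat.cast_sum, hsum]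

/-- Few queries have more than a fifth of their elements in a set `V` that has at most `R` elements
in every block. This is Markov's inequality for the product of the factors `n / R` over the
elements in `V`. -/
lemma card_heavy_le {k n R : ℕ} (hR : 0 < R) (hRn : R ≤ n) (V : Finset (Fin k × Fin n))
    (hV : ∀ i, #{b | (i, b) ∈ V} ≤ R) :
    (#{σ : Fin k → Fin n | (k / 5 : ℝ) ≤ #{i | (i, σ i) ∈ V}} : ℝ) ≤
      (2 * n : ℝ) ^ k * ((R : ℝ) / n) ^ ((k : ℝ) / 5) := by
  have hn : (0 : ℝ) < n := by exact_mod_cast hR.trans_le hRn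
  have hR' : (0 : ℝ) < R := by exact_mod_cast hR
  set B : ℝ := n / R with hB
  have hB1 : 1 ≤ B := by
    rw [hB, le_div_iff₀ hR', one_mul]; exact_mod_cast hRn
  have hB0 : 0 < B := by linarith
  have key : ∑ σ : Fin k → Fin n, ∏ i, (if (i, σ i) ∈ V then B else 1) ≤ (2 * n : ℝ) ^ k := by
    have h := (prod_univ_sum (fun _ : Fin k => (univ : Finset (Fin n)))
      (fun i b => if (i, b) ∈ V then B else (1 : ℝ)))
    rw [Fintype.piFinset_univ] at h
    rw [← h]
    calc ∏ i : Fin k, ∑ b : Fin n, (if (i, b) ∈ V then B else (1 : ℝ))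
        ≤ ∏ i : Fin k, (2 * n : ℝ) := by
          refine prod_le_prod (fun i _ => sum_nonneg fun b _ => by split_ifs <;> positivity)
            fun i _ => ?_
          calc ∑ b : Fin n, (if (i, b) ∈ V then B else (1 : ℝ))
              ≤ ∑ b : Fin n, ((if (i, b) ∈ V then B else (0 : ℝ)) + 1) := by
                refine sum_le_sum fun b _ => ?_
                split_ifs <;> linarith
            _ = #{b | (i, b) ∈ V} * B + n := by
                rw [sum_add_distrib, ← sum_filter, sum_const, sum_const]
                simp
            _ ≤ R * B + n := by
                gcongr; exact_mod_cast hV i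
            _ = 2 * n := by rw [hB]; field_simp; ring
      _ = (2 * n : ℝ) ^ k := by simp
  have h2 : (#{σ : Fin k → Fin n | (k / 5 : ℝ) ≤ #{i | (i, σ i) ∈ V}} : ℝ) * B ^ ((k : ℝ) / 5) ≤
      ∑ σ : Fin k → Fin n, ∏ i, (if (i, σ i) ∈ V then B else 1) := by
    rw [← nsmul_eq_mul, ← sum_const]
    refine (sum_le_sum fun σ hσ => ?_).trans
      (sum_le_sum_of_subset_of_nonneg (filter_subset _ univ) fun σ _ _ =>
        prod_nonneg fun i _ => by split_ifs <;> positivity)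
    rw [mem_filter] at hσ
    rw [prod_ite, prod_const, prod_const_one, mul_one, ← Real.rpow_natCast]
    exact Real.rpow_le_rpow_of_exponent_le hB1 hσ.2
  have h3 : ((R : ℝ) / n) ^ ((k : ℝ) / 5) = (B ^ ((k : ℝ) / 5))⁻¹ := by
    rw [← Real.inv_rpow hB0.le, hB, inv_div]
  rw [h3, ← div_eq_mul_inv, le_div_iff₀ (by positivity)]
  exact h2.trans key

lemma card_graph_sdiff {k n : ℕ} (σ : Fin k → Fin n) (V : Finset (Fin k × Fin n)) :
    #(graph σ \ V) + #{i | (i, σ i) ∈ V} = k := by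
  have h : #(graph σ ∩ V) = #{i | (i, σ i) ∈ V} := by
    symm
    refine card_bij (fun i _ => (i, σ i)) ?_ ?_ ?_
    · intro i hi
      rw [mem_inter, mem_graph]
      exact ⟨rfl, by simpa using hi⟩
    · intro i _ j _ h
      exact (Prod.ext_iff.1 h).1
    · rintro ⟨i, b⟩ h
      rw [mem_inter, mem_graph] at h
      obtain ⟨h1, h2⟩ := h
      simp only at h1
      subst h1
      exact ⟨i, by simpa using h2, rfl⟩
  rw [← h, card_sdiff_add_card_inter, card_graph]

lemma exp_neg_two_div_le : Real.exp (-(2 / 25)) + 1 / 100 ≤ (9367 / 10000 : ℝ) := by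
  have h : (2 / 25 + 1 : ℝ) ≤ Real.exp (2 / 25) := Real.add_one_le_exp _
  rw [Real.exp_neg]
  have : (Real.exp (2 / 25))⁻¹ ≤ (2 / 25 + 1 : ℝ)⁻¹ := inv_anti₀ (by norm_num) h
  norm_num at this ⊢
  linarith

/-- Averaged over a large family `F` of queries, the new elements of a query (those outside `V`)
cost a constant factor, as most queries have at least `4k/5` new elements. -/
lemma sum_exp_sdiff_le {k n R : ℕ} (hk : 0 < k) (hR : 0 < R) (hRn : R ≤ n)
    (F : Finset (Fin k → Fin n))
    (hF : (2 * n : ℝ) ^ k * ((R : ℝ) / n) ^ ((k : ℝ) / 5) ≤ #F / 100)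
    (V : Finset (Fin k × Fin n)) (hV : ∀ i, #{b | (i, b) ∈ V} ≤ R) :
    ∑ σ ∈ F, Real.exp (-(#(graph σ \ V) : ℝ) / (10 * k)) ≤ #F * (9367 / 10000) := by
  have hk' : (0 : ℝ) < k := by exact_mod_cast hk
  calc ∑ σ ∈ F, Real.exp (-(#(graph σ \ V) : ℝ) / (10 * k))
      ≤ ∑ σ ∈ F, (Real.exp (-(2 / 25)) +
          if (k / 5 : ℝ) ≤ #{i | (i, σ i) ∈ V} then 1 else 0) := by
        refine sum_le_sum fun σ _ => ?_
        have hc : (#(graph σ \ V) : ℝ) + #{i | (i, σ i) ∈ V} = k := by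
          exact_mod_cast card_graph_sdiff σ V
        split_ifs with h
        · have : Real.exp (-(#(graph σ \ V) : ℝ) / (10 * k)) ≤ 1 := by
            rw [Real.exp_le_one_iff, neg_div]
            have : (0 : ℝ) ≤ (#(graph σ \ V) : ℝ) / (10 * k) := by positivity
            linarith
          have := Real.exp_pos (-(2 / 25))
          linarith
        · rw [add_zero, Real.exp_le_exp, div_le_iff₀ (by positivity)]
          push Not at h
          nlinarith
    _ = #F * Real.exp (-(2 / 25)) + #{σ ∈ F | (k / 5 : ℝ) ≤ #{i | (i, σ i) ∈ V}} := by
        rw [sum_add_distrib, ← sum_filter]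
        simp
    _ ≤ #F * Real.exp (-(2 / 25)) + #F / 100 := by
        gcongr
        refine le_trans ?_ ((card_heavy_le hR hRn V hV).trans hF)
        exact_mod_cast card_le_card (filter_subset_filter _ (subset_univ _))
    _ = #F * (Real.exp (-(2 / 25)) + 1 / 100) := by ring
    _ ≤ _ := by
        gcongr
        exact exp_neg_two_div_le

/-- The moments of the number of queries in `F` that a random database misses. The `j`-th moment
counts `j`-tuples of queries that are missed together; they are revealed one after the other, and
`V` collects the elements that are already known to be missed. -/
lemma sum_card_pow_le {k n R : ℕ} (hk : 0 < k) (hR : 0 < R) (hRn : R ≤ n)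
    (F : Finset (Fin k → Fin n))
    (hF : (2 * n : ℝ) ^ k * ((R : ℝ) / n) ^ ((k : ℝ) / 5) ≤ #F / 100) (j : ℕ) :
    ∀ V : Finset (Fin k × Fin n), (∀ i, #{b | (i, b) ∈ V} + j ≤ R) →
      ∑ τ : Fin n → Color k with Misses τ V, (#{σ ∈ F | Misses τ (graph σ)} : ℝ) ^ j ≤
        (10 * k : ℝ) ^ n * Real.exp (-(#V : ℝ) / (10 * k)) * (#F * (9367 / 10000)) ^ j := by
  induction j with
  | zero =>
    intro V _
    simpa using card_misses_le hk V
  | succ j ih =>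
    intro V hV
    calc ∑ τ : Fin n → Color k with Misses τ V, (#{σ ∈ F | Misses τ (graph σ)} : ℝ) ^ (j + 1)
        = ∑ τ : Fin n → Color k with Misses τ V, ∑ σ ∈ F with Misses τ (graph σ),
            (#{σ ∈ F | Misses τ (graph σ)} : ℝ) ^ j := by
          refine sum_congr rfl fun τ _ => ?_
          rw [sum_const, nsmul_eq_mul, pow_succ, mul_comm]
      _ = ∑ σ ∈ F, ∑ τ : Fin n → Color k with Misses τ (V ∪ graph σ),
            (#{σ ∈ F | Misses τ (graph σ)} : ℝ) ^ j := by
          refine sum_comm' fun τ σ => ?_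
          simp only [mem_filter, mem_univ, true_and, misses_union]
          tauto
      _ ≤ ∑ σ ∈ F, (10 * k : ℝ) ^ n * Real.exp (-(#(V ∪ graph σ) : ℝ) / (10 * k)) *
            (#F * (9367 / 10000)) ^ j := by
          refine sum_le_sum fun σ _ => ih _ fun i => ?_
          have h1 : #{b | (i, b) ∈ V ∪ graph σ} ≤ #{b | (i, b) ∈ V} + 1 := by
            calc #{b | (i, b) ∈ V ∪ graph σ} ≤ #(({b | (i, b) ∈ V} : Finset (Fin n)) ∪ {σ i}) := by
                  refine card_le_card fun b hb => ?_
                  simp only [mem_filter, mem_univ, true_and, mem_union, mem_graph,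
                    mem_singleton] at hb ⊢
                  exact hb.imp_right Eq.symm
              _ ≤ _ := by
                  refine (card_union_le _ _).trans ?_
                  rw [card_singleton]
          have := hV i
          omega
      _ = (10 * k : ℝ) ^ n * Real.exp (-(#V : ℝ) / (10 * k)) * (#F * (9367 / 10000)) ^ j *
            ∑ σ ∈ F, Real.exp (-(#(graph σ \ V) : ℝ) / (10 * k)) := by
          rw [mul_sum]
          refine sum_congr rfl fun σ _ => ?_
          have : (#(V ∪ graph σ) : ℝ) = #V + #(graph σ \ V) := by
            rw [← union_sdiff_self_eq_union, card_union_of_disjoint disjoint_sdiff]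
            push_cast
            rfl
          rw [this, neg_add, add_div, Real.exp_add]
          ring
      _ ≤ (10 * k : ℝ) ^ n * Real.exp (-(#V : ℝ) / (10 * k)) * (#F * (9367 / 10000)) ^ j *
            (#F * (9367 / 10000)) := by
          refine mul_le_mul_of_nonneg_left ?_ (by positivity)
          exact sum_exp_sdiff_le hk hR hRn F hF V fun i => by have := hV i; omega
      _ = _ := by ring

/-- If `F` is a large family of queries, then an exponentially small fraction of all databases
misses a fraction `50/53` of `F`. -/
lemma card_mostly_missed_le {k n R : ℕ} (hk : 0 < k) (hR : 0 < R) (hRn : R ≤ n)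
    (F : Finset (Fin k → Fin n)) (hF0 : 0 < #F)
    (hF : (2 * n : ℝ) ^ k * ((R : ℝ) / n) ^ ((k : ℝ) / 5) ≤ #F / 100) :
    (#{τ : Fin n → Color k | (#F : ℝ) ≤ 53 / 50 * #{σ ∈ F | Misses τ (graph σ)}} : ℝ) ≤
      (10 * k : ℝ) ^ n * (993 / 1000) ^ R := by
  have hF' : (0 : ℝ) < #F := by exact_mod_cast hF0
  have hmom := sum_card_pow_le hk hR hRn F hF R ∅ (by simp)
  have hall : ({τ : Fin n → Color k | Misses τ ∅} : Finset _) = univ := by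
    ext τ; simp [Misses]
  rw [hall] at hmom
  simp only [card_empty, Nat.cast_zero, neg_zero, zero_div, Real.exp_zero, mul_one] at hmom
  have h1 : (#{τ : Fin n → Color k | (#F : ℝ) ≤ 53 / 50 * #{σ ∈ F | Misses τ (graph σ)}} : ℝ) *
      (50 / 53 * #F) ^ R ≤ (10 * k : ℝ) ^ n * (#F * (9367 / 10000)) ^ R := by
    refine le_trans ?_ hmom
    rw [← nsmul_eq_mul, ← sum_const]
    refine (sum_le_sum fun τ hτ => ?_).trans
      (sum_le_sum_of_subset_of_nonneg (filter_subset _ univ) fun τ _ _ => by positivity)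
    rw [mem_filter] at hτ
    refine pow_le_pow_left₀ (by positivity) ?_ _
    linarith [hτ.2]
  have h2 : (#{τ : Fin n → Color k | (#F : ℝ) ≤ 53 / 50 * #{σ ∈ F | Misses τ (graph σ)}} : ℝ) *
      (50 / 53 * #F) ^ R ≤ (10 * k : ℝ) ^ n * (993 / 1000) ^ R * (50 / 53 * #F) ^ R := by
    refine h1.trans ?_
    rw [mul_assoc, ← mul_pow]
    refine mul_le_mul_of_nonneg_left (pow_le_pow_left₀ (by positivity) ?_ _) (by positivity)
    linarith
  exact le_of_mul_le_mul_right h2 (by positivity)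

/-! ### Transcripts of query algorithms -/

/-- The cells that the algorithm reads on the memory `m`, with their contents. -/
def trace {s w : ℕ} : QueryAlg s w → CellMemory s w → List (Fin s × Word w)
  | .answer _, _ => []
  | .probe cell next, m => (cell, m cell) :: trace (next (m cell)) m

lemma length_trace {s w : ℕ} (A : QueryAlg s w) (m : CellMemory s w) :
    (trace A m).length = A.accesses m := by
  induction A with
  | answer b => rfl
  | probe cell next ih => simp [trace, QueryAlg.accesses, ih]

lemma snd_of_mem_trace {s w : ℕ} (A : QueryAlg s w) (m : CellMemory s w) :
    ∀ p ∈ trace A m, m p.1 = p.2 := by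
  induction A with
  | answer b => simp [trace]
  | probe cell next ih =>
    intro p hp
    rw [trace, List.mem_cons] at hp
    rcases hp with rfl | hp
    · rfl
    · exact ih _ p hp

/-- An algorithm does the same on two memories that agree on the cells that it reads. -/
lemma trace_congr {s w : ℕ} (A : QueryAlg s w) (m m' : CellMemory s w)
    (h : ∀ p ∈ trace A m', m p.1 = p.2) : trace A m = trace A m' ∧ A.run m = A.run m' := by
  induction A with
  | answer b => exact ⟨rfl, rfl⟩
  | probe cell next ih =>
    simp only [trace, List.mem_cons, forall_eq_or_imp] at h
    obtain ⟨h1, h2⟩ := h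
    simp only [trace, QueryAlg.run, h1]
    obtain ⟨h3, h4⟩ := ih _ h2
    exact ⟨by rw [h3], h4⟩

lemma exists_ofFn_reduceOption {α : Type*} {t : ℕ} (l : List α) (hl : l.length ≤ t) :
    ∃ f : Fin t → Option α, (List.ofFn f).reduceOption = l := by
  induction t generalizing l with
  | zero =>
    rw [List.length_eq_zero_iff.1 (Nat.le_zero.1 hl)]
    exact ⟨fun _ => none, rfl⟩
  | succ t ih =>
    cases l with
    | nil =>
      obtain ⟨f, hf⟩ := ih [] (by simp)
      exact ⟨Fin.cons none f, by simp [List.ofFn_succ, hf]⟩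
    | cons a l =>
      obtain ⟨f, hf⟩ := ih l (by simpa using hl)
      exact ⟨Fin.cons (some a) f, by simp [List.ofFn_succ, hf]⟩

/-- All lists of length at most `t`. -/
def listsUpTo (α : Type*) [Fintype α] [DecidableEq α] (t : ℕ) : Finset (List α) :=
  univ.image fun f : Fin t → Option α => (List.ofFn f).reduceOption

lemma mem_listsUpTo {α : Type*} [Fintype α] [DecidableEq α] {t : ℕ} {l : List α}
    (hl : l.length ≤ t) : l ∈ listsUpTo α t := by
  obtain ⟨f, hf⟩ := exists_ofFn_reduceOption l hl
  exact mem_image.2 ⟨f, mem_univ _, hf⟩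

lemma card_listsUpTo_le (α : Type*) [Fintype α] [DecidableEq α] (t : ℕ) :
    #(listsUpTo α t) ≤ (Fintype.card α + 1) ^ t := by
  refine card_image_le.trans ?_
  rw [card_univ, Fintype.card_fun, Fintype.card_option, Fintype.card_fin]

/-- Given the memory, a transcript is determined by the addresses in it. -/
lemma exists_transcripts {s w t : ℕ} (m : CellMemory s w) :
    ∃ T : Finset (List (Fin s × Word w)), #T ≤ (s + 1) ^ t ∧
      (∀ l ∈ T, l.length ≤ t ∧ ∀ p ∈ l, m p.1 = p.2) ∧
      ∀ A : QueryAlg s w, A.accesses m ≤ t → trace A m ∈ T := by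
  refine ⟨(listsUpTo (Fin s) t).image fun l => l.map fun c => (c, m c), ?_, ?_, ?_⟩
  · refine card_image_le.trans ?_
    simpa using card_listsUpTo_le (Fin s) t
  · intro l hl
    obtain ⟨a, ha, rfl⟩ := mem_image.1 hl
    obtain ⟨f, -, rfl⟩ := mem_image.1 ha
    refine ⟨?_, fun p hp => ?_⟩
    · rw [List.length_map]
      exact (List.reduceOption_length_le _).trans (List.length_ofFn).le
    · obtain ⟨c, -, rfl⟩ := List.mem_map.1 hp
      rfl
  · intro A hA
    refine mem_image.2 ⟨(trace A m).map Prod.fst, mem_listsUpTo ?_, ?_⟩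
    · rwa [List.length_map, length_trace]
    · rw [List.map_map]
      conv_rhs => rw [← List.map_id (trace A m)]
      refine List.map_congr_left fun p hp => ?_
      simp [snd_of_mem_trace A m p hp]

open Classical in
/-- The queries that can see the transcript `l` and then answer "no". -/
noncomputable def rejecting {s w : ℕ} {Q : Type*} [Fintype Q] (alg : Q → QueryAlg s w)
    (l : List (Fin s × Word w)) : Finset Q :=
  {q | ∃ m, trace (alg q) m = l ∧ (alg q).run m = false}

lemma mem_rejecting {s w : ℕ} {Q : Type*} [Fintype Q] {alg : Q → QueryAlg s w}
    {l : List (Fin s × Word w)} {m : CellMemory s w} (hl : ∀ p ∈ l, m p.1 = p.2) {q : Q} :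
    q ∈ rejecting alg l ↔ trace (alg q) m = l ∧ (alg q).run m = false := by
  classical
  simp only [rejecting, mem_filter, mem_univ, true_and]
  constructor
  · rintro ⟨m', rfl, h⟩
    obtain ⟨h1, h2⟩ := trace_congr (alg q) m m' hl
    exact ⟨h1, h2.trans h⟩
  · rintro ⟨h1, h2⟩
    exact ⟨m, h1, h2⟩

/-! ### The deterministic lower bound -/

/-- The weight of the answer "no" to the query `σ` on the database `τ`: a reward if that is right,
a penalty if it is wrong. -/
noncomputable def noWeight {k n : ℕ} (τ : Fin n → Color k) (σ : Fin k → Fin n) : ℝ :=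
  if Misses τ (graph σ) then 3 / 50 else -1

lemma noWeight_le {k n : ℕ} (τ : Fin n → Color k) (σ : Fin k → Fin n) :
    noWeight τ σ ≤ 3 / 50 := by
  unfold noWeight
  split_ifs <;> norm_num

/-- Some transcript that is consistent with the database `τ` is shared by many queries which answer
"no" on it, and rightly so in most cases. -/
lemma exists_transcript {k n s w t : ℕ} (m : CellMemory s w) (τ : Fin n → Color k)
    (alg : (Fin k → Fin n) → QueryAlg s w) (ht : ∀ σ, (alg σ).accesses m ≤ t) {ν : ℝ}
    (hν : 0 ≤ ν) (h : ν * (n : ℝ) ^ k ≤ ∑ σ with (alg σ).run m = false, noWeight τ σ) :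
    ∃ l ∈ listsUpTo (Fin s × Word w) t,
      ν * (n : ℝ) ^ k / ((s : ℝ) + 1) ^ t ≤ #(rejecting alg l) ∧
      (#(rejecting alg l) : ℝ) ≤ 53 / 50 * #{σ ∈ rejecting alg l | Misses τ (graph σ)} := by
  obtain ⟨T, hT, hTm, hTt⟩ := exists_transcripts (t := t) m
  have hT0 : (0 : ℝ) < ((s : ℝ) + 1) ^ t := by positivity
  have hb0 : 0 ≤ ν * (n : ℝ) ^ k / ((s : ℝ) + 1) ^ t := by positivity
  have hTne : T.Nonempty := ⟨_, hTt (.answer true) (Nat.zero_le t)⟩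
  obtain ⟨l, hlT, hl⟩ := exists_le_sum_fiber_of_maps_to_of_nsmul_le_sum
    (s := ({σ | (alg σ).run m = false} : Finset (Fin k → Fin n))) (t := T)
    (f := fun σ => trace (alg σ) m) (w := fun σ => noWeight τ σ)
    (b := ν * (n : ℝ) ^ k / ((s : ℝ) + 1) ^ t) (fun σ _ => hTt _ (ht σ)) hTne (by
      rw [nsmul_eq_mul]
      refine le_trans ?_ h
      calc (#T : ℝ) * (ν * (n : ℝ) ^ k / ((s : ℝ) + 1) ^ t)
          ≤ ((s : ℝ) + 1) ^ t * (ν * (n : ℝ) ^ k / ((s : ℝ) + 1) ^ t) := by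
            gcongr; exact_mod_cast hT
        _ = ν * (n : ℝ) ^ k := by field_simp)
  have hfib : ({σ ∈ ({σ | (alg σ).run m = false} : Finset (Fin k → Fin n)) |
      trace (alg σ) m = l} : Finset _) = rejecting alg l := by
    ext σ
    rw [mem_rejecting (hTm l hlT).2, mem_filter, mem_filter]
    simp only [mem_univ, true_and, and_comm]
  rw [hfib] at hl
  have hle : ∑ σ ∈ rejecting alg l, noWeight τ σ ≤ #(rejecting alg l) := by
    rw [card_eq_sum_ones, Nat.cast_sum, Nat.cast_one]
    exact sum_le_sum fun σ _ => (noWeight_le τ σ).trans (by norm_num)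
  have hsplit : ∑ σ ∈ rejecting alg l, noWeight τ σ =
      53 / 50 * #{σ ∈ rejecting alg l | Misses τ (graph σ)} - #(rejecting alg l) := by
    have h1 : ∀ σ, noWeight τ σ = 53 / 50 * (if Misses τ (graph σ) then 1 else 0) - 1 := by
      intro σ
      unfold noWeight
      split_ifs <;> norm_num
    simp only [h1]
    rw [sum_sub_distrib, ← mul_sum, ← sum_filter]
    simp
  exact ⟨l, mem_listsUpTo (hTm l hlT).1, hl.trans hle, by linarith⟩

/-- If the "no" answers of a deterministic data structure are right often enough, then its
transcripts, together, cover a constant fraction of the databases. But there are at most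
`(s 2^w + 1)^t` transcripts and, by `card_mostly_missed_le`, each covers few databases. -/
lemma le_transcripts_mul_pow {k n s w t R : ℕ} (hk : 0 < k) (hR : 0 < R) (hRn : R ≤ n) {μ : ℝ}
    (hμ : 0 < μ) (enc : (Fin n → Color k) → CellMemory s w)
    (alg : (Fin k → Fin n) → QueryAlg s w) (ht : ∀ τ σ, (alg σ).accesses (enc τ) ≤ t)
    (h : μ * ((10 * k : ℝ) ^ n * (n : ℝ) ^ k) ≤
      ∑ τ, ∑ σ with (alg σ).run (enc τ) = false, noWeight τ σ)
    (hsmall : (2 * n : ℝ) ^ k * ((R : ℝ) / n) ^ ((k : ℝ) / 5) ≤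
      μ / 2 * (n : ℝ) ^ k / ((s : ℝ) + 1) ^ t / 100) :
    μ / 2 ≤ ((s : ℝ) * 2 ^ w + 1) ^ t * (993 / 1000) ^ R := by
  have hk' : (0 : ℝ) < k := by exact_mod_cast hk
  have hn' : (0 : ℝ) < n := by exact_mod_cast hR.trans_le hRn
  let Z : (Fin n → Color k) → ℝ := fun τ => ∑ σ with (alg σ).run (enc τ) = false, noWeight τ σ
  let G : Finset (Fin n → Color k) := {τ | μ / 2 * (n : ℝ) ^ k ≤ Z τ}
  have hZ : ∀ τ, Z τ ≤ (n : ℝ) ^ k := by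
    intro τ
    calc Z τ ≤ ∑ σ with (alg σ).run (enc τ) = false, (1 : ℝ) :=
          sum_le_sum fun σ _ => (noWeight_le τ σ).trans (by norm_num)
      _ ≤ ∑ σ : Fin k → Fin n, (1 : ℝ) :=
          sum_le_sum_of_subset_of_nonneg (filter_subset _ univ) fun _ _ _ => zero_le_one
      _ = (n : ℝ) ^ k := by simp
  -- A constant fraction of the databases has a score that is at least half of the average.
  have hG : μ / 2 * (10 * k : ℝ) ^ n ≤ #G := by
    have h1 : ∑ τ, Z τ ≤ ∑ τ : Fin n → Color k,
        (μ / 2 * (n : ℝ) ^ k + if μ / 2 * (n : ℝ) ^ k ≤ Z τ then (n : ℝ) ^ k else 0) := by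
      refine sum_le_sum fun τ _ => ?_
      split_ifs with h'
      · have := hZ τ
        have : 0 < μ / 2 * (n : ℝ) ^ k := by positivity
        linarith
      · rw [add_zero]
        exact (not_le.1 h').le
    rw [sum_add_distrib, ← sum_filter, sum_const, sum_const, card_univ, Fintype.card_fun,
      Fintype.card_prod, Fintype.card_fin, Fintype.card_fin, Fintype.card_fin, nsmul_eq_mul,
      nsmul_eq_mul] at h1
    have h2 := h.trans h1
    push_cast at h2
    have h3 : (μ / 2 * (10 * k : ℝ) ^ n) * (n : ℝ) ^ k ≤ #G * (n : ℝ) ^ k := by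
      rw [mul_comm (k : ℝ) 10] at h2
      have e : ({τ | μ / 2 * (n : ℝ) ^ k ≤ Z τ} : Finset (Fin n → Color k)) = G := rfl
      rw [e] at h2
      linarith
    exact le_of_mul_le_mul_right h3 (by positivity)
  have hcover : G ⊆ (listsUpTo (Fin s × Word w) t).biUnion fun l =>
      {τ | μ / 2 * (n : ℝ) ^ k / ((s : ℝ) + 1) ^ t ≤ #(rejecting alg l) ∧
        (#(rejecting alg l) : ℝ) ≤ 53 / 50 * #{σ ∈ rejecting alg l | Misses τ (graph σ)}} := by
    intro τ hτ
    obtain ⟨l, hl, h1, h2⟩ := exists_transcript (enc τ) τ alg (ht τ) (by positivity)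
      (mem_filter.1 hτ).2
    exact mem_biUnion.2 ⟨l, hl, mem_filter.2 ⟨mem_univ _, h1, h2⟩⟩
  have hcard : (#G : ℝ) ≤ #(listsUpTo (Fin s × Word w) t) *
      ((10 * k : ℝ) ^ n * (993 / 1000) ^ R) := by
    calc (#G : ℝ) ≤ ∑ l ∈ listsUpTo (Fin s × Word w) t, (#{τ : Fin n → Color k |
          μ / 2 * (n : ℝ) ^ k / ((s : ℝ) + 1) ^ t ≤ #(rejecting alg l) ∧
          (#(rejecting alg l) : ℝ) ≤ 53 / 50 * #{σ ∈ rejecting alg l | Misses τ (graph σ)}} : ℝ) := by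
          exact_mod_cast (card_le_card hcover).trans card_biUnion_le
      _ ≤ ∑ l ∈ listsUpTo (Fin s × Word w) t, (10 * k : ℝ) ^ n * (993 / 1000) ^ R := by
          refine sum_le_sum fun l _ => ?_
          by_cases hl : μ / 2 * (n : ℝ) ^ k / ((s : ℝ) + 1) ^ t ≤ #(rejecting alg l)
          · have hpos : (0 : ℝ) < #(rejecting alg l) := lt_of_lt_of_le (by positivity) hl
            refine le_trans ?_ (card_mostly_missed_le hk hR hRn (rejecting alg l)
              (by exact_mod_cast hpos) (hsmall.trans (by gcongr)))
            exact_mod_cast card_le_card fun τ hτ => by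
              rw [mem_filter] at hτ ⊢
              exact ⟨hτ.1, hτ.2.2⟩
          · rw [filter_false_of_mem fun τ _ h' => hl h'.1, card_empty, Nat.cast_zero]
            positivity
      _ = _ := by rw [sum_const, nsmul_eq_mul]
  have hlists : (#(listsUpTo (Fin s × Word w) t) : ℝ) ≤ ((s : ℝ) * 2 ^ w + 1) ^ t := by
    have := card_listsUpTo_le (Fin s × Word w) t
    simp only [Fintype.card_prod, Fintype.card_fin, Fintype.card_fun, Fintype.card_bool] at this
    exact_mod_cast this
  have h4 : (μ / 2) * (10 * k : ℝ) ^ n ≤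
      ((s : ℝ) * 2 ^ w + 1) ^ t * (993 / 1000) ^ R * (10 * k : ℝ) ^ n := by
    calc (μ / 2) * (10 * k : ℝ) ^ n ≤ #(listsUpTo (Fin s × Word w) t) *
          ((10 * k : ℝ) ^ n * (993 / 1000) ^ R) := hG.trans hcard
      _ ≤ ((s : ℝ) * 2 ^ w + 1) ^ t * ((10 * k : ℝ) ^ n * (993 / 1000) ^ R) := by gcongr
      _ = _ := by ring
  exact le_of_mul_le_mul_right h4 (by positivity)

/-! ### Concentration on finite product spaces -/

/-- Hoeffding's inequality for uniform independent samples, with a worse constant. -/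
lemma card_sum_ge_le {Ω : Type*} [Fintype Ω] [DecidableEq Ω] {d : ℕ} (X : Ω → ℝ)
    (hX : ∀ ω, |X ω| ≤ 1) (hmean : ∑ ω, X ω ≤ 0) {η : ℝ} (hη : 0 ≤ η) (hη2 : η ≤ 2) :
    (#{r : Fin d → Ω | η * d ≤ ∑ c, X (r c)} : ℝ) ≤
      (Fintype.card (Fin d → Ω) : ℝ) * Real.exp (-(η ^ 2 * d / 4)) := by
  have h1 : (#{r : Fin d → Ω | η * d ≤ ∑ c, X (r c)} : ℝ) * Real.exp (η / 2 * (η * d)) ≤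
      (∑ ω, Real.exp (η / 2 * X ω)) ^ d := by
    rw [Fintype.sum_pow, ← nsmul_eq_mul, ← sum_const]
    refine (sum_le_sum fun r hr => ?_).trans
      (sum_le_sum_of_subset_of_nonneg (filter_subset _ univ) fun r _ _ =>
        prod_nonneg fun c _ => (Real.exp_pos _).le)
    rw [← Real.exp_sum, ← mul_sum, Real.exp_le_exp]
    exact mul_le_mul_of_nonneg_left (mem_filter.1 hr).2 (by positivity)
  have h2 : ∑ ω, Real.exp (η / 2 * X ω) ≤ Fintype.card Ω * Real.exp (η ^ 2 / 4) := by
    calc ∑ ω, Real.exp (η / 2 * X ω) ≤ ∑ ω, (1 + η / 2 * X ω + η ^ 2 / 4) := by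
          refine sum_le_sum fun ω _ => ?_
          have habs := abs_le.1 (hX ω)
          have hy : |η / 2 * X ω| ≤ 1 := by
            rw [abs_mul, abs_of_nonneg (by positivity : 0 ≤ η / 2)]
            nlinarith [hX ω, abs_nonneg (X ω)]
          have h3 := (abs_le.1 (Real.abs_exp_sub_one_sub_id_le hy)).2
          have h4 : X ω ^ 2 ≤ 1 := by nlinarith
          have h5 : (η / 2 * X ω) ^ 2 ≤ η ^ 2 / 4 := by
            rw [mul_pow]; nlinarith [sq_nonneg η]
          linarith
      _ = Fintype.card Ω * (1 + η ^ 2 / 4) + η / 2 * ∑ ω, X ω := by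
          rw [sum_add_distrib, sum_add_distrib, ← mul_sum, sum_const, sum_const, card_univ,
            nsmul_eq_mul, nsmul_eq_mul]
          ring
      _ ≤ Fintype.card Ω * (1 + η ^ 2 / 4) := by nlinarith
      _ ≤ _ := by
          gcongr
          linarith [Real.add_one_le_exp (η ^ 2 / 4)]
  have h3 : (#{r : Fin d → Ω | η * d ≤ ∑ c, X (r c)} : ℝ) * Real.exp (η / 2 * (η * d)) ≤
      (Fintype.card Ω : ℝ) ^ d * Real.exp (η ^ 2 / 4 * d) := by
    refine h1.trans ?_
    rw [mul_comm (η ^ 2 / 4) (d : ℝ), Real.exp_nat_mul, ← mul_pow]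
    exact pow_le_pow_left₀ (sum_nonneg fun ω _ => (Real.exp_pos _).le) h2 d
  have h4 : Real.exp (-(η ^ 2 * d / 4)) = Real.exp (η ^ 2 / 4 * d) / Real.exp (η / 2 * (η * d)) := by
    rw [← Real.exp_sub]; congr 1; ring
  rw [h4, ← mul_div_assoc, le_div_iff₀ (Real.exp_pos _)]
  simpa using h3

/-! ### The majority of random signs -/

/-- The sign `±1` of a bit. -/
def sign (b : Bool) : ℝ := if b then 1 else -1

lemma sign_not (b : Bool) : sign (!b) = -sign b := by cases b <;> simp [sign]

lemma sign_sq (b : Bool) : sign b ^ 2 = 1 := by cases b <;> simp [sign]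

/-- The indicator of `a ≠ b`. -/
def mismatch (a b : Bool) : ℝ := if a ≠ b then 1 else 0

lemma sign_mul_sign (a b : Bool) : sign a * sign b = 1 - 2 * mismatch a b := by
  cases a <;> cases b <;> simp [sign, mismatch] <;> norm_num

variable {J : Type*}

/-- Flipping one random bit is a measure preserving involution. -/
lemma sum_eq_zero_of_flip [Fintype J] [DecidableEq J] (x : J) (f : (J → Bool) → ℝ)
    (hf : ∀ ω, f (Function.update ω x (!ω x)) = -f ω) : ∑ ω, f ω = 0 := by
  have hinv : Function.Involutive fun ω : J → Bool => Function.update ω x (!ω x) := by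
    intro ω
    simp
  have h : ∑ ω, f ω = ∑ ω, f (Function.update ω x (!ω x)) :=
    (Equiv.sum_comp hinv.toPerm f).symm
  simp only [hf, sum_neg_distrib] at h
  linarith

/-- The sum of the signs of the bits in `I`. -/
def signSum (I : Finset J) (ω : J → Bool) : ℝ := ∑ x ∈ I, sign (ω x)

lemma signSum_update [DecidableEq J] {I : Finset J} {x : J} (hx : x ∉ I) (ω : J → Bool) (b : Bool) :
    signSum I (Function.update ω x b) = signSum I ω :=
  sum_congr rfl fun y hy => by rw [Function.update_of_ne (fun h : y = x => hx (h ▸ hy))]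

lemma sum_pow_mul_sign [Fintype J] [DecidableEq J] {I : Finset J} {x : J} (hx : x ∉ I) (j : ℕ) :
    ∑ ω, signSum I ω ^ j * sign (ω x) = 0 := by
  refine sum_eq_zero_of_flip x _ fun ω => ?_
  rw [signSum_update hx, Function.update_self, sign_not]
  ring

lemma sum_signSum_sq [Fintype J] [DecidableEq J] (I : Finset J) :
    ∑ ω, signSum I ω ^ 2 = #I * (Fintype.card (J → Bool) : ℝ) := by
  induction I using Finset.induction_on with
  | empty => simp [signSum]
  | insert x I hx ih =>
    have h : ∀ ω, signSum (insert x I) ω ^ 2 =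
        signSum I ω ^ 2 + 2 * (signSum I ω ^ 1 * sign (ω x)) + 1 := by
      intro ω
      have := sign_sq (ω x)
      rw [signSum, sum_insert hx, ← signSum]
      linear_combination this
    simp only [h]
    rw [sum_add_distrib, sum_add_distrib, ← mul_sum, sum_pow_mul_sign hx, ih, sum_const, card_univ,
      card_insert_of_notMem hx, nsmul_eq_mul]
    push_cast
    ring

lemma sum_signSum_pow_four_le [Fintype J] [DecidableEq J] (I : Finset J) :
    ∑ ω, signSum I ω ^ 4 ≤ 3 * (#I : ℝ) ^ 2 * (Fintype.card (J → Bool) : ℝ) := by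
  induction I using Finset.induction_on with
  | empty => simp [signSum]
  | insert x I hx ih =>
    have h : ∀ ω, signSum (insert x I) ω ^ 4 =
        signSum I ω ^ 4 + 4 * (signSum I ω ^ 3 * sign (ω x)) + 6 * signSum I ω ^ 2 +
          4 * (signSum I ω ^ 1 * sign (ω x)) + 1 := by
      intro ω
      have := sign_sq (ω x)
      rw [signSum, sum_insert hx, ← signSum]
      linear_combination (6 * signSum I ω ^ 2 + 4 * signSum I ω * sign (ω x) +
        sign (ω x) ^ 2 + 1) * this
    simp only [h]
    rw [sum_add_distrib, sum_add_distrib, sum_add_distrib, sum_add_distrib, ← mul_sum, ← mul_sum,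
      ← mul_sum, sum_pow_mul_sign hx, sum_pow_mul_sign hx, sum_signSum_sq, sum_const, card_univ,
      card_insert_of_notMem hx, nsmul_eq_mul]
    push_cast
    have : (0 : ℝ) ≤ 2 * (Fintype.card (J → Bool) : ℝ) := by positivity
    linarith

/-- The first absolute moment is bounded below by the second and the fourth, as
`u ≥ u² - u⁴/4` for `u ≥ 0`. -/
lemma le_sum_abs_signSum [Fintype J] [DecidableEq J] (I : Finset J) (hI : 0 < #I) :
    √(#I : ℝ) / 4 * (Fintype.card (J → Bool) : ℝ) ≤ ∑ ω, |signSum I ω| := by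
  set k : ℝ := (#I : ℝ) with hk
  have hk0 : 0 < k := by rw [hk]; exact_mod_cast hI
  set a : ℝ := √k with ha
  have ha0 : 0 < a := Real.sqrt_pos.2 hk0
  have hak : a ^ 2 = k := Real.sq_sqrt hk0.le
  have hpt : ∀ v : ℝ, v ^ 2 / a - v ^ 4 / (4 * a ^ 3) ≤ |v| := by
    intro v
    have key : ∀ u : ℝ, 0 ≤ u → u ^ 2 - u ^ 4 / 4 ≤ u := by
      intro u hu
      have : 0 ≤ u * (u + 12 / 5) * (u - 6 / 5) ^ 2 := by positivity
      nlinarith [mul_nonneg hu hu]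
    have h := mul_le_mul_of_nonneg_left (key (|v| / a) (by positivity)) ha0.le
    have e1 : a * ((|v| / a) ^ 2 - (|v| / a) ^ 4 / 4) = v ^ 2 / a - v ^ 4 / (4 * a ^ 3) := by
      rw [div_pow, div_pow, sq_abs, (by decide : Even 4).pow_abs]
      field_simp
    have e2 : a * (|v| / a) = |v| := by field_simp
    rwa [e1, e2] at h
  have h2 := sum_signSum_sq I
  have h4 := sum_signSum_pow_four_le I
  rw [← hk] at h2 h4
  calc a / 4 * (Fintype.card (J → Bool) : ℝ)
      = (k * (Fintype.card (J → Bool) : ℝ)) / a -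
          (3 * k ^ 2 * (Fintype.card (J → Bool) : ℝ)) / (4 * a ^ 3) := by
        rw [← hak]; field_simp; ring
    _ ≤ (∑ ω, signSum I ω ^ 2) / a - (∑ ω, signSum I ω ^ 4) / (4 * a ^ 3) := by
        rw [h2]; gcongr
    _ = ∑ ω, (signSum I ω ^ 2 / a - signSum I ω ^ 4 / (4 * a ^ 3)) := by
        rw [sum_sub_distrib, sum_div, sum_div]
    _ ≤ _ := sum_le_sum fun ω _ => hpt _

/-- The majority of the bits in `I`, with ties decided in favour of `true`. -/
noncomputable def majority (I : Finset J) (ω : J → Bool) : Bool := decide (0 ≤ signSum I ω)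

lemma sign_majority_mul (I : Finset J) (ω : J → Bool) :
    signSum I ω * sign (majority I ω) = |signSum I ω| := by
  by_cases h : 0 ≤ signSum I ω
  · simp [majority, sign, h, abs_of_nonneg h]
  · simp [majority, sign, h, abs_of_neg (not_le.1 h)]

lemma majority_singleton (x : J) (ω : J → Bool) : majority {x} ω = ω x := by
  cases h : ω x <;> simp [majority, signSum, sign, h]

/-- The majority of the bits in `I` is correlated with every one of them, by symmetry. -/
lemma le_sum_sign_mul_majority [Fintype J] [DecidableEq J] {I : Finset J} {x : J} (hx : x ∈ I) :
    (Fintype.card (J → Bool) : ℝ) / (4 * √(#I : ℝ)) ≤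
      ∑ ω, sign (ω x) * sign (majority I ω) := by
  have hI : 0 < #I := card_pos.2 ⟨x, hx⟩
  have hsymm : ∀ y ∈ I, ∑ ω, sign (ω y) * sign (majority I ω) =
      ∑ ω, sign (ω x) * sign (majority I ω) := by
    intro y hy
    have hS : ∀ ω : J → Bool, signSum I (ω ∘ Equiv.swap x y) = signSum I ω := by
      intro ω
      refine sum_equiv (Equiv.swap x y) (fun z => ?_) (fun z _ => rfl)
      by_cases h1 : z = x
      · subst h1; simp [hx, hy]
      by_cases h2 : z = y
      · subst h2; simp [hx, hy]
      rw [Equiv.swap_apply_of_ne_of_ne h1 h2]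
    have h := Equiv.sum_comp (Equiv.arrowCongr (Equiv.swap x y) (Equiv.refl Bool))
      fun ω : J → Bool => sign (ω x) * sign (majority I ω)
    rw [← h]
    refine sum_congr rfl fun ω _ => ?_
    have e : (Equiv.arrowCongr (Equiv.swap x y) (Equiv.refl Bool)) ω = ω ∘ Equiv.swap x y := by
      ext z; simp [Equiv.arrowCongr]
    rw [e]
    simp only [majority, hS, Function.comp_apply, Equiv.swap_apply_left]
  have htot : (#I : ℝ) * ∑ ω, sign (ω x) * sign (majority I ω) = ∑ ω, |signSum I ω| := by
    rw [← nsmul_eq_mul, ← sum_const, ← sum_congr rfl hsymm, sum_comm]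
    refine sum_congr rfl fun ω _ => ?_
    rw [← sum_mul, ← sign_majority_mul, signSum]
  have hk0 : (0 : ℝ) < #I := by exact_mod_cast hI
  have ha0 := Real.sqrt_pos.2 hk0
  have hsq := Real.mul_self_sqrt hk0.le
  have h := le_sum_abs_signSum I hI
  rw [← htot] at h
  refine le_of_mul_le_mul_left (le_trans (le_of_eq ?_) h) hk0
  rw [mul_div_assoc', div_eq_iff (by positivity)]
  linear_combination (-Fintype.card (J → Bool) : ℝ) * hsq

/-! ### The random embedding into the Hamming cube -/

section Embedding

/-- The image of the element `x`. The `d` coordinates are independent when `r` is random. -/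
def point {d : ℕ} (r : Fin d → J → Bool) (x : J) : Cube d := fun c => r c x

/-- The image of the query `I`: the coordinatewise majority of the images of its elements. -/
noncomputable def majorityPoint {d : ℕ} (r : Fin d → J → Bool) (I : Finset J) : Cube d :=
  fun c => majority I (r c)

lemma cast_hammingDist {d : ℕ} (p q : Cube d) :
    (hammingDist p q : ℝ) = ∑ c, mismatch (p c) (q c) := by
  simp only [mismatch]
  rw [hammingDist, ← sum_filter, sum_const, nsmul_eq_mul, mul_one]

lemma hammingDist_majorityPoint_singleton {d : ℕ} (r : Fin d → J → Bool) (x : J) :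
    hammingDist (point r x) (majorityPoint r {x}) = 0 := by
  rw [hammingDist_eq_zero]
  funext c
  exact (majority_singleton x (r c)).symm

lemma majority_update [DecidableEq J] {I : Finset J} {x : J} (hx : x ∉ I) (ω : J → Bool)
    (b : Bool) : majority I (Function.update ω x b) = majority I ω := by
  simp only [majority, signSum_update hx]

/-- The embedding `r` separates the elements of `I` from all others by their distances from the
image of `I`. -/
def Separates {d : ℕ} (r : Fin d → J → Bool) (η : ℝ) (I : Finset J) : Prop :=
  (∀ x ∈ I, (hammingDist (point r x) (majorityPoint r I) : ℝ) ≤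
    (1 / 2 - 1 / (8 * √(#I : ℝ)) + η) * d) ∧
  ∀ x ∉ I, (1 / 2 - η) * d ≤ (hammingDist (point r x) (majorityPoint r I) : ℝ)

variable [Fintype J] [DecidableEq J]

/-- The image of `x` is far from every point that is defined without reference to it. -/
lemma card_hammingDist_lt_le {d : ℕ} (x : J) (g : (J → Bool) → Bool)
    (hg : ∀ ω b, g (Function.update ω x b) = g ω) {η : ℝ} (hη : 0 ≤ η) (hη2 : η ≤ 2) :
    (#{r : Fin d → J → Bool | (hammingDist (point r x) fun c => g (r c) : ℝ) < (1 / 2 - η) * d} : ℝ)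
      ≤ (Fintype.card (Fin d → J → Bool) : ℝ) * Real.exp (-(η ^ 2 * d / 4)) := by
  let X : (J → Bool) → ℝ := fun ω => 1 / 2 - mismatch (ω x) (g ω)
  have hX : ∀ ω, |X ω| ≤ 1 := by
    intro ω
    simp only [X, mismatch]
    split_ifs <;> norm_num [abs_le]
  have hmean : ∑ ω, X ω = 0 := by
    refine sum_eq_zero_of_flip x _ fun ω => ?_
    simp only [X, hg, Function.update_self]
    cases ω x <;> cases g ω <;> norm_num [mismatch]
  refine le_trans ?_ (card_sum_ge_le X hX hmean.le hη hη2)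
  refine Nat.cast_le.2 (card_le_card fun r hr => ?_)
  rw [mem_filter] at hr ⊢
  refine ⟨mem_univ _, ?_⟩
  have h := hr.2
  rw [cast_hammingDist] at h
  simp only [X, sum_sub_distrib, sum_const, card_univ, Fintype.card_fin, nsmul_eq_mul]
  simp only [point] at h
  linarith

/-- The image of `x ∈ I` is closer to the image of `I`, by the correlation of the majority with a
single bit. -/
lemma card_lt_hammingDist_le {d : ℕ} {I : Finset J} {x : J} (hx : x ∈ I) {η : ℝ} (hη : 0 ≤ η)
    (hη2 : η ≤ 2) :
    (#{r : Fin d → J → Bool | (1 / 2 - 1 / (8 * √(#I : ℝ)) + η) * d <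
        (hammingDist (point r x) (majorityPoint r I) : ℝ)} : ℝ)
      ≤ (Fintype.card (Fin d → J → Bool) : ℝ) * Real.exp (-(η ^ 2 * d / 4)) := by
  have hI : (1 : ℝ) ≤ #I := by exact_mod_cast card_pos.2 ⟨x, hx⟩
  have ha : 1 ≤ √(#I : ℝ) := by rwa [Real.one_le_sqrt]
  set β : ℝ := 1 / (8 * √(#I : ℝ)) with hβ
  have hβ0 : 0 ≤ β := by positivity
  have hβ1 : β ≤ 1 / 8 := by
    rw [hβ]
    exact one_div_le_one_div_of_le (by norm_num) (by linarith)
  let X : (J → Bool) → ℝ := fun ω => mismatch (ω x) (majority I ω) - (1 / 2 - β)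
  have hX : ∀ ω, |X ω| ≤ 1 := by
    intro ω
    simp only [X, mismatch]
    split_ifs <;> rw [abs_le] <;> constructor <;> linarith
  have hmean : ∑ ω, X ω ≤ 0 := by
    have h1 : ∀ ω, X ω = β - 1 / 2 * (sign (ω x) * sign (majority I ω)) := by
      intro ω
      rw [sign_mul_sign]
      simp only [X]
      ring
    simp only [h1]
    rw [sum_sub_distrib, ← mul_sum, sum_const, card_univ, nsmul_eq_mul]
    have h2 := le_sum_sign_mul_majority hx
    have h3 : (Fintype.card (J → Bool) : ℝ) / (4 * √(#I : ℝ)) =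
        2 * ((Fintype.card (J → Bool) : ℝ) * β) := by
      rw [hβ]
      field_simp
      norm_num
    linarith
  refine le_trans ?_ (card_sum_ge_le X hX hmean hη hη2)
  refine Nat.cast_le.2 (card_le_card fun r hr => ?_)
  rw [mem_filter] at hr ⊢
  refine ⟨mem_univ _, ?_⟩
  have h := hr.2
  rw [cast_hammingDist] at h
  simp only [X, sum_sub_distrib, sum_const, card_univ, Fintype.card_fin, nsmul_eq_mul]
  simp only [point, majorityPoint] at h
  linarith

open Classical in
/-- A fixed query is separated, and all points are distinct, except with small probability. -/
lemma card_not_separates_le {d : ℕ} (hd : 0 < d) (I : Finset J) {η : ℝ} (hη : 0 ≤ η)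
    (hη2 : η < 1 / 2) :
    (#{r : Fin d → J → Bool | ¬ (Function.Injective (point r) ∧ Separates r η I)} : ℝ) ≤
      2 * (Fintype.card J : ℝ) ^ 2 * Real.exp (-(η ^ 2 * d / 4)) *
        (Fintype.card (Fin d → J → Bool) : ℝ) := by
  have hd' : (0 : ℝ) < d := by exact_mod_cast hd
  set e := (Fintype.card (Fin d → J → Bool) : ℝ) * Real.exp (-(η ^ 2 * d / 4)) with he
  have he0 : 0 ≤ e := by positivity
  let B : J → Finset (Fin d → J → Bool) := fun x =>
    if x ∈ I then univ.filter fun r => ((1 / 2 - 1 / (8 * √(#I : ℝ)) + η) * d <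
        (hammingDist (point r x) (majorityPoint r I) : ℝ))
    else univ.filter fun r =>
      (hammingDist (point r x) (majorityPoint r I) : ℝ) < (1 / 2 - η) * d
  let D : J × J → Finset (Fin d → J → Bool) := fun p =>
    if p.1 = p.2 then ∅ else univ.filter fun r =>
      (hammingDist (point r p.1) (point r p.2) : ℝ) < (1 / 2 - η) * d
  have hB : ∀ x, (#(B x) : ℝ) ≤ e := by
    intro x
    by_cases hx : x ∈ I
    · simp only [B, if_pos hx]
      exact card_lt_hammingDist_le hx hη (by linarith)
    · simp only [B, if_neg hx]
      exact card_hammingDist_lt_le x (majority I) (majority_update hx) hη (by linarith)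
  have hD : ∀ p, (#(D p) : ℝ) ≤ e := by
    rintro ⟨x, y⟩
    by_cases hxy : x = y
    · simp only [D, if_pos hxy, card_empty, Nat.cast_zero]
      exact he0
    · simp only [D, if_neg hxy]
      exact card_hammingDist_lt_le x (fun ω => ω y)
        (fun ω b => Function.update_of_ne (Ne.symm hxy) _ _) hη (by linarith)
  have hsub : ({r : Fin d → J → Bool | ¬ (Function.Injective (point r) ∧ Separates r η I)} :
      Finset _) ⊆ univ.biUnion B ∪ univ.biUnion D := by
    intro r hr
    by_contra hcon
    simp only [mem_union, mem_biUnion, mem_univ, true_and, not_or, not_exists] at hcon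
    obtain ⟨h1, h2⟩ := hcon
    refine (mem_filter.1 hr).2 ⟨?_, ?_, ?_⟩
    · intro x y hxy
      by_contra hne
      have h := h2 (x, y)
      simp only [D, if_neg hne, mem_filter, mem_univ, true_and, hxy, hammingDist_self,
        Nat.cast_zero] at h
      exact h (mul_pos (by linarith) hd')
    · intro x hx
      have h := h1 x
      simp only [B, if_pos hx, mem_filter, mem_univ, true_and, not_lt] at h
      exact h
    · intro x hx
      have h := h1 x
      simp only [B, if_neg hx, mem_filter, mem_univ, true_and, not_lt] at h
      exact h
  have hJ : (Fintype.card J : ℝ) ≤ (Fintype.card J : ℝ) ^ 2 := by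
    exact_mod_cast Nat.le_self_pow two_ne_zero _
  calc (#{r : Fin d → J → Bool | ¬ (Function.Injective (point r) ∧ Separates r η I)} : ℝ)
      ≤ ∑ x, (#(B x) : ℝ) + ∑ p, (#(D p) : ℝ) := by
        exact_mod_cast (card_le_card hsub).trans ((card_union_le _ _).trans
          (add_le_add card_biUnion_le card_biUnion_le))
    _ ≤ ∑ x : J, e + ∑ p : J × J, e :=
        add_le_add (sum_le_sum fun x _ => hB x) (sum_le_sum fun p _ => hD p)
    _ = (Fintype.card J + (Fintype.card J : ℝ) ^ 2) * e := by
        simp only [sum_const, card_univ, Fintype.card_prod, nsmul_eq_mul, Nat.cast_mul]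
        ring
    _ ≤ (2 * (Fintype.card J : ℝ) ^ 2) * e := by gcongr; linarith
    _ = _ := by rw [he]; ring

open Classical in
/-- One embedding that is injective and separates most queries exists by averaging. -/
lemma exists_embedding {Q : Type*} [Fintype Q] [Nonempty Q] {d : ℕ} (hd : 0 < d)
    (I : Q → Finset J) {η ν : ℝ} (hη : 0 ≤ η) (hη2 : η < 1 / 2) (hν : ν < 1)
    (h : 2 * (Fintype.card J : ℝ) ^ 2 * Real.exp (-(η ^ 2 * d / 4)) ≤ ν) :
    ∃ r : Fin d → J → Bool, Function.Injective (point r) ∧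
      (#{q | ¬ Separates r η (I q)} : ℝ) ≤ ν * Fintype.card Q := by
  let bad : (Fin d → J → Bool) → Q → Prop := fun r q =>
    ¬ (Function.Injective (point r) ∧ Separates r η (I q))
  have hQ : (0 : ℝ) < Fintype.card Q := by exact_mod_cast Fintype.card_pos
  have hsum : ∑ r, (#{q | bad r q} : ℝ) ≤ ∑ r : Fin d → J → Bool, ν * Fintype.card Q := by
    calc ∑ r, (#{q | bad r q} : ℝ) = ∑ q, (#{r | bad r q} : ℝ) := by
          simp only [card_filter, Nat.cast_sum]
          exact sum_comm
      _ ≤ ∑ q : Q, ν * (Fintype.card (Fin d → J → Bool) : ℝ) :=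
          sum_le_sum fun q _ => (card_not_separates_le hd (I q) hη hη2).trans (by gcongr)
      _ = _ := by
          simp only [sum_const, card_univ, nsmul_eq_mul]
          ring
  obtain ⟨r, -, hr⟩ := exists_le_of_sum_le univ_nonempty hsum
  -- Less than all queries are bad for `r`, so that `r` is injective.
  have hinj : Function.Injective (point r) := by
    by_contra hcon
    have hall : ({q | bad r q} : Finset Q) = univ :=
      filter_true_of_mem fun q _ hq => hcon hq.1
    rw [hall, card_univ] at hr
    nlinarith
  refine ⟨r, hinj, le_trans ?_ hr⟩
  refine Nat.cast_le.2 (card_le_card fun q hq => ?_)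
  rw [mem_filter] at hq ⊢
  exact ⟨hq.1, fun h' => hq.2 h'.2⟩

end Embedding

/-! ### From randomized to deterministic data structures -/

open Classical in
/-- Some outcome is at least as good as the average, for a weighted count of events. -/
lemma exists_sum_weight_ge {α ι : Type*} [Fintype ι] (p : PMF α) (E : ι → Set α) (c : ι → ℝ) :
    ∃ a, ∑ i, c i * (p.toOuterMeasure (E i)).toReal ≤ ∑ i, if a ∈ E i then c i else 0 := by
  let out : α → ι → Bool := fun a i => decide (a ∈ E i)
  let q : PMF (ι → Bool) := p.map out
  have hq : ∀ i, (p.toOuterMeasure (E i)).toReal =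
      ∑ o : ι → Bool, if o i = true then (q o).toReal else 0 := by
    intro i
    have hpre : E i = out ⁻¹' {o | o i = true} := by
      ext a
      simp [out]
    rw [hpre, ← PMF.toOuterMeasure_map_apply, PMF.toOuterMeasure_apply_fintype,
      ENNReal.toReal_sum]
    · refine sum_congr rfl fun o _ => ?_
      rw [Set.indicator_apply]
      simp only [Set.mem_ofPred_eq]
      split_ifs <;> rfl
    · intro o _
      rw [Set.indicator_apply]
      split_ifs
      · exact PMF.apply_ne_top _ _
      · exact ENNReal.zero_ne_top
  have hq1 : ∑ o, (q o).toReal = 1 := by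
    have h := q.tsum_coe
    rw [tsum_fintype] at h
    rw [← ENNReal.toReal_sum fun o _ => PMF.apply_ne_top _ _, h, ENNReal.toReal_one]
  have hswap : ∑ i, c i * (p.toOuterMeasure (E i)).toReal =
      ∑ o, (q o).toReal * ∑ i, if o i = true then c i else 0 := by
    simp only [hq, mul_sum]
    rw [sum_comm]
    refine sum_congr rfl fun o _ => sum_congr rfl fun i _ => ?_
    split_ifs <;> ring
  by_contra hcon
  push Not at hcon
  set S := ∑ i, c i * (p.toOuterMeasure (E i)).toReal with hS
  have hlt : ∀ o, (q o).toReal ≠ 0 → (∑ i, if o i = true then c i else 0) < S := by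
    intro o ho
    have hmem : o ∈ q.support := by
      rw [PMF.mem_support_iff]
      intro h0
      exact ho (by rw [h0, ENNReal.toReal_zero])
    rw [PMF.support_map] at hmem
    obtain ⟨a, -, rfl⟩ := hmem
    simpa [out] using hcon a
  have hne : ∃ o, (q o).toReal ≠ 0 := by
    by_contra h0
    push Not at h0
    simp [h0] at hq1
  obtain ⟨o, ho⟩ := hne
  have hfin : S < ∑ o, (q o).toReal * S := by
    calc S = ∑ o, (q o).toReal * ∑ i, if o i = true then c i else 0 := hswap
      _ < ∑ o, (q o).toReal * S := by
        refine sum_lt_sum (fun o _ => ?_) ⟨o, mem_univ _, ?_⟩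
        · by_cases h0 : (q o).toReal = 0
          · rw [h0, zero_mul, zero_mul]
          · exact mul_le_mul_of_nonneg_left (hlt o h0).le ENNReal.toReal_nonneg
        · exact mul_lt_mul_of_pos_left (hlt o ho)
            (lt_of_le_of_ne ENNReal.toReal_nonneg (Ne.symm ho))
  rw [← sum_mul, hq1, one_mul] at hfin
  exact lt_irrefl _ hfin

/-! ### Set disjointness as a nearest neighbor problem -/

/-- The elements of the database `τ` are `(τ b, b)` for `b : Fin n`. -/
abbrev Element (k n : ℕ) : Type := Color k × Fin n

/-- The elements asked for by the query `σ`. -/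
def queryElements {k n : ℕ} (σ : Fin k → Fin n) : Finset (Element k n) :=
  univ.image fun i => ((i, 0), σ i)

lemma card_queryElements {k n : ℕ} (σ : Fin k → Fin n) : #(queryElements σ) = k := by
  rw [queryElements, card_image_of_injective, card_univ, Fintype.card_fin]
  intro i j h
  simp only [Prod.mk.injEq] at h
  exact h.1.1

lemma misses_graph_iff {k n : ℕ} {τ : Fin n → Color k} {σ : Fin k → Fin n} :
    Misses τ (graph σ) ↔ ∀ b, (τ b, b) ∉ queryElements σ := by
  rw [misses_graph]
  simp only [queryElements, mem_image, mem_univ, true_and, Prod.mk.injEq, not_exists, not_and]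
  constructor
  · rintro h b i hi rfl
    exact h i hi.symm
  · intro h i hi
    exact h (σ i) i hi.symm rfl

/-- The `n` points that represent the database `τ`. -/
def databasePoints {k n d : ℕ} (r : Fin d → Element k n → Bool)
    (hr : Function.Injective (point r)) (τ : Fin n → Color k) : PointSet d n :=
  ⟨univ.image fun b => point r (τ b, b), by
    rw [card_image_of_injective, card_univ, Fintype.card_fin]
    exact fun b b' h => (Prod.ext_iff.1 (hr h)).2⟩

/-- The query `σ` is at distance at most `L` from its elements, and at distance at least
`(1 + ε) L` from all others. -/
def GapAt {k n d : ℕ} (r : Fin d → Element k n → Bool) (ε : ℝ) (L : ℕ) (σ : Fin k → Fin n) : Prop :=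
  (∀ x ∈ queryElements σ, hammingDist (point r x) (majorityPoint r (queryElements σ)) ≤ L) ∧
  ∀ x ∉ queryElements σ,
    (1 + ε) * L ≤ (hammingDist (point r x) (majorityPoint r (queryElements σ)) : ℝ)

lemma eq_of_annAcceptable {k n d L : ℕ} {ε : ℝ} {r : Fin d → Element k n → Bool}
    (hr : Function.Injective (point r)) {τ : Fin n → Color k} {σ : Fin k → Fin n}
    (hσ : GapAt r ε L σ) {b : Bool}
    (hb : annAcceptable ε L (databasePoints r hr τ) (majorityPoint r (queryElements σ)) b) :
    b = !decide (Misses τ (graph σ)) := by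
  by_cases hm : Misses τ (graph σ)
  · rw [decide_eq_true hm, Bool.not_true]
    rw [misses_graph_iff] at hm
    refine hb.2 fun p hp => ?_
    obtain ⟨b, -, rfl⟩ := mem_image.1 hp
    exact hσ.2 _ (hm b)
  · rw [decide_eq_false hm, Bool.not_false]
    rw [misses_graph_iff] at hm
    push Not at hm
    obtain ⟨b, hb'⟩ := hm
    exact hb.1 ⟨point r (τ b, b), mem_image.2 ⟨b, mem_univ _, rfl⟩, hσ.1 _ hb'⟩

lemma card_apply_eq_mul {β C : Type*} [Fintype β] [DecidableEq β] [Fintype C] [DecidableEq C]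
    (b : β) (c : C) : #{τ : β → C | τ b = c} * Fintype.card C = Fintype.card (β → C) := by
  have h : ({τ : β → C | τ b = c} : Finset _) =
      Fintype.piFinset fun b' => if b = b' then {c} else univ := by
    ext τ
    simp only [mem_filter, mem_univ, true_and, Fintype.mem_piFinset]
    constructor
    · intro h b'
      split_ifs with hb
      · rw [mem_singleton, ← hb, h]
      · exact mem_univ _
    · intro h
      simpa using h b
  have h2 : Fintype.card C = ∏ b', if b = b' then Fintype.card C else 1 := by
    rw [prod_ite_eq, if_pos (mem_univ _)]
  conv_lhs => rw [h, Fintype.card_piFinset, h2, ← prod_mul_distrib]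
  rw [Fintype.card_fun, ← card_univ (α := β), ← prod_const]
  refine prod_congr rfl fun b' _ => ?_
  split_ifs <;> simp

/-- A query hits at most a tenth of the databases, by the union bound. -/
lemma card_not_misses_le {k n : ℕ} (hk : 0 < k) (σ : Fin k → Fin n) :
    (#{τ : Fin n → Color k | ¬ Misses τ (graph σ)} : ℝ) ≤ (10 * k : ℝ) ^ n / 10 := by
  have hk' : (0 : ℝ) < k := by exact_mod_cast hk
  have h1 : ({τ : Fin n → Color k | ¬ Misses τ (graph σ)} : Finset _) ⊆
      univ.biUnion fun i : Fin k => {τ | τ (σ i) = (i, 0)} := by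
    intro τ hτ
    rw [mem_filter, misses_graph] at hτ
    simpa using hτ.2
  have h2 : ∀ i : Fin k, (#{τ : Fin n → Color k | τ (σ i) = (i, 0)} : ℝ) =
      (10 * k : ℝ) ^ n / (10 * k) := by
    intro i
    have := card_apply_eq_mul (σ i) ((i, 0) : Color k)
    rw [Fintype.card_fun] at this
    simp only [Fintype.card_prod, Fintype.card_fin] at this
    rw [eq_div_iff (by positivity), mul_comm (10 : ℝ)]
    exact_mod_cast this
  calc (#{τ : Fin n → Color k | ¬ Misses τ (graph σ)} : ℝ)
      ≤ ∑ i : Fin k, (#{τ : Fin n → Color k | τ (σ i) = (i, 0)} : ℝ) := by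
        exact_mod_cast (card_le_card h1).trans card_biUnion_le
    _ = (10 * k : ℝ) ^ n / 10 := by
        simp only [h2, sum_const, card_univ, Fintype.card_fin, nsmul_eq_mul]
        field_simp

open Classical in
/-- A randomized data structure for the nearest neighbor problem contains a deterministic one for
set disjointness whose "no" answers are right often enough, in the sense of `noWeight`. -/
lemma exists_deterministic {k n d s w t L : ℕ} {ε : ℝ} (hk : 0 < k)
    (r : Fin d → Element k n → Bool) (hr : Function.Injective (point r))
    (hbad : (#{σ : Fin k → Fin n | ¬ GapAt r ε L σ} : ℝ) ≤ 1 / 1000 * (n : ℝ) ^ k)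
    (S : RandCellProbeScheme (PointSet d n) (Cube d) s w t) (hS : S.Solves (annAcceptable ε L)) :
    ∃ (enc : (Fin n → Color k) → CellMemory s w) (alg : (Fin k → Fin n) → QueryAlg s w),
      (∀ τ σ, (alg σ).accesses (enc τ) ≤ t) ∧
      1 / 1000 * ((10 * k : ℝ) ^ n * (n : ℝ) ^ k) ≤
        ∑ τ, ∑ σ with (alg σ).run (enc τ) = false, noWeight τ σ := by
  let enc (X : CellProbeScheme (PointSet d n) (Cube d) s w t) (τ : Fin n → Color k) :=
    X.encode (databasePoints r hr τ)
  let alg (X : CellProbeScheme (PointSet d n) (Cube d) s w t) (σ : Fin k → Fin n) :=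
    X.query (majorityPoint r (queryElements σ))
  let E : (Fin n → Color k) × (Fin k → Fin n) →
      Set (CellProbeScheme (PointSet d n) (Cube d) s w t) :=
    fun p => {X | (alg X p.2).run (enc X p.1) = !decide (Misses p.1 (graph p.2))}
  let c : (Fin n → Color k) × (Fin k → Fin n) → ℝ := fun p =>
    if Misses p.1 (graph p.2) then 3 / 50 else 1
  let hit : (Fin n → Color k) → (Fin k → Fin n) → ℝ := fun τ σ =>
    if ¬ Misses τ (graph σ) then 1 else 0
  have hE : ∀ τ σ, GapAt r ε L σ → 2 / 3 ≤ (S.toOuterMeasure (E (τ, σ))).toReal := by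
    intro τ σ hσ
    have h1 := (hS (databasePoints r hr τ) (majorityPoint r (queryElements σ))).trans
      (S.toOuterMeasure.mono (fun X hX => eq_of_annAcceptable hr hσ hX :
        {X | annAcceptable ε L (databasePoints r hr τ) (majorityPoint r (queryElements σ))
          (X.output (databasePoints r hr τ) (majorityPoint r (queryElements σ)))} ⊆ E (τ, σ)))
    have hle : S.toOuterMeasure (E (τ, σ)) ≤ 1 := by
      rw [PMF.toOuterMeasure_apply, ← S.tsum_coe]
      exact ENNReal.tsum_le_tsum fun X => Set.indicator_le_self _ _ X
    have h2 := ENNReal.toReal_mono (ne_top_of_le_ne_top ENNReal.one_ne_top hle) h1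
    simpa using h2
  obtain ⟨X, hX⟩ := exists_sum_weight_ge S E c
  have hX' : ∑ p, c p * (S.toOuterMeasure (E p)).toReal ≤ ∑ p, if X ∈ E p then c p else 0 := by
    convert hX
  refine ⟨enc X, alg X, fun τ σ => X.queryTime_le _ _, ?_⟩
  have hscore : ∑ τ, ∑ σ with (alg X σ).run (enc X τ) = false, noWeight τ σ =
      (∑ p, if X ∈ E p then c p else 0) - ∑ τ, ∑ σ, hit τ σ := by
    rw [Fintype.sum_prod_type, ← sum_sub_distrib]
    refine sum_congr rfl fun τ _ => ?_
    rw [← sum_sub_distrib, sum_filter]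
    refine sum_congr rfl fun σ _ => ?_
    simp only [E, c, hit, noWeight, Set.mem_ofPred_eq]
    by_cases hm : Misses τ (graph σ) <;> cases (alg X σ).run (enc X τ) <;> simp [hm]
  have hexp : ∑ τ : Fin n → Color k, ∑ σ : Fin k → Fin n,
      ((1 / 25 : ℝ) + (47 / 75) * hit τ σ - if ¬ GapAt r ε L σ then 1 else 0) ≤
      ∑ p, c p * (S.toOuterMeasure (E p)).toReal := by
    rw [Fintype.sum_prod_type]
    refine sum_le_sum fun τ _ => sum_le_sum fun σ _ => ?_
    by_cases hσ : GapAt r ε L σ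
    · have := hE τ σ hσ
      simp only [c, hit, hσ, not_true_eq_false, if_false]
      by_cases hm : Misses τ (graph σ)
      · simp only [hm, not_true_eq_false, if_true, if_false]
        linarith
      · simp only [hm, not_false_eq_true, if_true, if_false]
        linarith
    · have : (0 : ℝ) ≤ c (τ, σ) * (S.toOuterMeasure (E (τ, σ))).toReal := by
        refine mul_nonneg ?_ ENNReal.toReal_nonneg
        simp only [c]
        split_ifs <;> norm_num
      refine le_trans ?_ this
      simp only [hit, hσ, not_false_eq_true, if_true]
      split_ifs <;> norm_num
  have hhit : ∑ τ : Fin n → Color k, ∑ σ : Fin k → Fin n, hit τ σ ≤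
      (10 * k : ℝ) ^ n * (n : ℝ) ^ k / 10 := by
    rw [sum_comm]
    calc ∑ σ : Fin k → Fin n, ∑ τ : Fin n → Color k, hit τ σ
        ≤ ∑ σ : Fin k → Fin n, (10 * k : ℝ) ^ n / 10 := by
          refine sum_le_sum fun σ _ => ?_
          simp only [hit]
          rw [← sum_filter, sum_const, nsmul_eq_mul, mul_one]
          exact card_not_misses_le hk σ
      _ = _ := by
          rw [sum_const, card_univ, Fintype.card_fun, Fintype.card_fin, Fintype.card_fin,
            nsmul_eq_mul]
          push_cast
          ring
  have hcardD : (Fintype.card (Fin n → Color k) : ℝ) = (10 * k : ℝ) ^ n := by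
    simp [mul_comm]
  have hcardQ : (Fintype.card (Fin k → Fin n) : ℝ) = (n : ℝ) ^ k := by simp
  have hexp' : ∑ τ : Fin n → Color k, ∑ σ : Fin k → Fin n,
      ((1 / 25 : ℝ) + (47 / 75) * hit τ σ - if ¬ GapAt r ε L σ then 1 else 0) =
      (10 * k : ℝ) ^ n * (n : ℝ) ^ k / 25 + 47 / 75 * (∑ τ, ∑ σ, hit τ σ) -
        (10 * k : ℝ) ^ n * #{σ : Fin k → Fin n | ¬ GapAt r ε L σ} := by
    simp only [sum_sub_distrib, sum_add_distrib, ← mul_sum, ← sum_filter, sum_const, card_univ,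
      nsmul_eq_mul, hcardD, hcardQ, mul_one]
    ring
  rw [hexp'] at hexp
  rw [hscore]
  have hbad' : (10 * k : ℝ) ^ n * #{σ : Fin k → Fin n | ¬ GapAt r ε L σ} ≤
      1 / 1000 * ((10 * k : ℝ) ^ n * (n : ℝ) ^ k) := by
    calc _ ≤ (10 * k : ℝ) ^ n * (1 / 1000 * (n : ℝ) ^ k) := by gcongr
      _ = _ := by ring
  have hpos : 0 ≤ (10 * k : ℝ) ^ n * (n : ℝ) ^ k := by positivity
  have hall := hexp.trans hX'
  linarith

/-! ### Choice of the parameters -/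

/-- Queries with `Θ(1/ε²)` elements can be embedded in dimension `O(max 1 (1/ε²) log n)`: the
correlation `1/(8√k)` of a bit with the majority of `k` bits has to be at least `ε`. For large `ε`
queries have one element, and the embedding maps the query to that element. -/
lemma exists_gap_embedding (ε : ℝ) (hε : 0 < ε) :
    ∃ k : ℕ, 0 < k ∧ 1 / (128 * ε ^ 2) ≤ (k : ℝ) ∧ ∃ N : ℕ, ∀ n : ℕ, N ≤ n → ∀ d : ℕ,
      12288 * max 1 (1 / ε ^ 2) * Real.log (n : ℝ) ≤ (d : ℝ) →
        ∃ L : ℕ, 1 ≤ L ∧ L ≤ d ∧ ∃ r : Fin d → Element k n → Bool,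
          Function.Injective (point r) ∧
            ∀ B : Finset (Fin k → Fin n), (∀ σ ∈ B, ¬ GapAt r ε L σ) →
              (#B : ℝ) ≤ 1 / 1000 * (n : ℝ) ^ k := by
  classical
  obtain ⟨k, hk, hk128, hkmax, hkε⟩ : ∃ k : ℕ, 0 < k ∧ 1 / (128 * ε ^ 2) ≤ (k : ℝ) ∧
      (k : ℝ) ≤ max 1 (1 / ε ^ 2) ∧ (k = 1 ∨ 64 * ε ^ 2 * k ≤ 1) := by
    by_cases h : ε ≤ 1 / 8
    · have hx : 1 ≤ 1 / (64 * ε ^ 2) := by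
        rw [le_div_iff₀ (by positivity)]
        nlinarith
      have h1 := Nat.floor_le (le_trans zero_le_one hx)
      have h2 := Nat.lt_floor_add_one (1 / (64 * ε ^ 2))
      have h3 : 1 ≤ ⌊1 / (64 * ε ^ 2)⌋₊ := Nat.le_floor (by simpa using hx)
      have h3' : (1 : ℝ) ≤ ⌊1 / (64 * ε ^ 2)⌋₊ := by exact_mod_cast h3
      refine ⟨⌊1 / (64 * ε ^ 2)⌋₊, h3, ?_, ?_, Or.inr ?_⟩
      · have : 1 / (128 * ε ^ 2) = 1 / (64 * ε ^ 2) / 2 := by field_simp; norm_num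
        linarith
      · refine h1.trans (le_max_of_le_right ?_)
        exact one_div_le_one_div_of_le (by positivity) (by nlinarith [sq_nonneg ε])
      · rw [le_div_iff₀ (by positivity)] at h1
        linarith
    · refine ⟨1, one_pos, ?_, by simp, Or.inl rfl⟩
      push Not at h
      rw [Nat.cast_one, div_le_one (by positivity)]
      nlinarith
  refine ⟨k, hk, hk128, max 3 (max (200000 * k ^ 2) ⌈Real.exp (4 * (1 + ε))⌉₊), ?_⟩
  intro n hn d hd
  obtain ⟨hn3, hn'⟩ := max_le_iff.1 hn
  obtain ⟨hnk, hnε⟩ := max_le_iff.1 hn'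
  have hnpos : (0 : ℝ) < n := by exact_mod_cast (by omega : 0 < n)
  have hlog1 : 4 * (1 + ε) ≤ Real.log n := by
    rw [Real.le_log_iff_exp_le hnpos]
    exact Nat.ceil_le.1 hnε
  have hk' : (1 : ℝ) ≤ k := by exact_mod_cast hk
  have hkl : 12288 * (k : ℝ) * Real.log n ≤ d := by
    refine le_trans ?_ hd
    have : 0 ≤ Real.log (n : ℝ) := by linarith
    gcongr
  have hdε : 4 * (1 + ε) ≤ d := by nlinarith
  have hdpos : 0 < d := by
    have : (0 : ℝ) < d := by linarith
    exact_mod_cast this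
  have ha : 1 ≤ √(k : ℝ) := by rwa [Real.one_le_sqrt]
  have hasq : √(k : ℝ) ^ 2 = k := Real.sq_sqrt (by linarith)
  set a := √(k : ℝ) with hadef
  set η : ℝ := 1 / (32 * a) with hη
  have hη0 : 0 ≤ η := by positivity
  have hη1 : η ≤ 1 / 32 := by
    rw [hη]
    exact one_div_le_one_div_of_le (by norm_num) (by linarith)
  have : NeZero n := ⟨by omega⟩
  have hsmall : 2 * (Fintype.card (Element k n) : ℝ) ^ 2 * Real.exp (-(η ^ 2 * d / 4)) ≤
      1 / 1000 := by
    have h1 : 3 * Real.log n ≤ η ^ 2 * d / 4 := by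
      have : η ^ 2 * d / 4 = d / (4096 * k) := by
        rw [hη, ← hasq]; field_simp; norm_num
      rw [this, le_div_iff₀ (by positivity)]
      linarith
    have h2 : Real.exp (-(η ^ 2 * d / 4)) ≤ 1 / (n : ℝ) ^ 3 := by
      calc Real.exp (-(η ^ 2 * d / 4)) ≤ Real.exp (-(3 * Real.log n)) :=
            Real.exp_le_exp.2 (by linarith)
        _ = 1 / (n : ℝ) ^ 3 := by
            rw [Real.exp_neg, ← Real.log_rpow hnpos, Real.exp_log (by positivity), one_div]
            norm_cast
    have h3 : (Fintype.card (Element k n) : ℝ) = 10 * k * n := by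
      simp only [Fintype.card_prod, Fintype.card_fin]
      push_cast
      ring
    have h4 : 200000 * (k : ℝ) ^ 2 ≤ n := by exact_mod_cast hnk
    calc 2 * (Fintype.card (Element k n) : ℝ) ^ 2 * Real.exp (-(η ^ 2 * d / 4))
        ≤ 2 * (10 * k * n) ^ 2 * (1 / (n : ℝ) ^ 3) := by rw [h3]; gcongr
      _ = 200 * (k : ℝ) ^ 2 / n := by field_simp; norm_num
      _ ≤ 1 / 1000 := by
          rw [div_le_iff₀ hnpos]
          linarith
  obtain ⟨r, hr, hbad⟩ := exists_embedding hdpos (queryElements (k := k) (n := n)) hη0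
    (by linarith) (by norm_num) hsmall
  -- It remains to choose `L` such that separated queries have the required gap.
  obtain ⟨L, hL1, hLd, hL⟩ : ∃ L : ℕ, 1 ≤ L ∧ L ≤ d ∧
      ∀ σ, Separates r η (queryElements σ) → GapAt r ε L σ := by
    rcases hkε with hk1 | hkε
    · refine ⟨1, le_rfl, hdpos, fun σ hσ => ⟨fun x hx => ?_, fun x hx => ?_⟩⟩
      · have hc : #(queryElements σ) = 1 := (card_queryElements σ).trans hk1
        obtain ⟨y, hy⟩ := card_eq_one.1 hc
        rw [hy, mem_singleton] at hx
        rw [hy, hx, hammingDist_majorityPoint_singleton]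
        exact Nat.zero_le 1
      · refine le_trans ?_ (hσ.2 x hx)
        rw [Nat.cast_one, mul_one]
        nlinarith
    · have hβ : 1 / (8 * a) = 4 * η := by rw [hη]; field_simp; norm_num
      have hεη : ε ≤ 4 * η := by
        rw [← hβ, le_div_iff₀ (by positivity)]
        have : (ε * (8 * a)) ^ 2 ≤ 1 ^ 2 := by
          rw [mul_pow, mul_pow, hasq]; linarith
        exact le_of_sq_le_sq this zero_le_one
      have hL0 : 0 ≤ (1 / 2 - 1 / (8 * a) + η) * d := by
        rw [hβ]
        exact mul_nonneg (by linarith) (by linarith)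
      have hfl := Nat.floor_le hL0
      refine ⟨⌊(1 / 2 - 1 / (8 * a) + η) * d⌋₊, ?_, ?_, fun σ hσ =>
        ⟨fun x hx => ?_, fun x hx => ?_⟩⟩
      · refine Nat.le_floor ?_
        rw [Nat.cast_one, hβ]
        nlinarith
      · refine Nat.cast_le.1 (hfl.trans ?_)
        rw [hβ]
        nlinarith
      · have h := hσ.1 x hx
        rw [card_queryElements] at h
        exact Nat.le_floor h
      · refine le_trans ?_ (hσ.2 x hx)
        calc (1 + ε) * (⌊(1 / 2 - 1 / (8 * a) + η) * d⌋₊ : ℝ)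
            ≤ (1 + 4 * η) * ((1 / 2 - 1 / (8 * a) + η) * d) := by gcongr
          _ = ((1 + 4 * η) * (1 / 2 - 3 * η)) * d := by rw [hβ]; ring
          _ ≤ (1 / 2 - η) * d := by
              refine mul_le_mul_of_nonneg_right ?_ (by linarith)
              nlinarith [sq_nonneg η]
  refine ⟨L, hL1, hLd, r, hr, fun B hB => ?_⟩
  have hQ : (Fintype.card (Fin k → Fin n) : ℝ) = (n : ℝ) ^ k := by simp
  rw [← hQ]
  refine le_trans (Nat.cast_le.2 (card_le_card fun σ hσ => ?_)) hbad
  exact mem_filter.2 ⟨mem_univ _, fun h => hB σ hσ (hL σ h)⟩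

open Filter in
/-- With `R = ⌊n^(1-δ/2)⌋` and less than `n^(δk/(20(t+1)))` cells, `le_transcripts_mul_pow` applies,
and its conclusion fails. -/
lemma exists_contradictory_parameters (k t : ℕ) (hk : 0 < k) {δ K : ℝ} (hδ : 0 < δ) (hδ1 : δ ≤ 1) :
    ∃ N : ℕ, ∀ n : ℕ, N ≤ n → ∃ R : ℕ, 0 < R ∧ R ≤ n ∧
      ∀ s w : ℕ, (w : ℝ) ≤ K * (n : ℝ) ^ (1 - δ) → (s : ℝ) ≤ (n : ℝ) ^ (δ / (20 * (t + 1)) * k) →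
        (2 * n : ℝ) ^ k * ((R : ℝ) / n) ^ ((k : ℝ) / 5) ≤
            1 / 1000 / 2 * (n : ℝ) ^ k / ((s : ℝ) + 1) ^ t / 100 ∧
          ((s : ℝ) * 2 ^ w + 1) ^ t * (993 / 1000) ^ R < 1 / 1000 / 2 := by
  have hk' : (0 : ℝ) < k := by exact_mod_cast hk
  have hrpow : ∀ {e : ℝ}, 0 < e → Tendsto (fun n : ℕ => (n : ℝ) ^ e) atTop atTop := fun he =>
    (tendsto_rpow_atTop he).comp tendsto_natCast_atTop_atTop
  have ev1 := (hrpow (by positivity : 0 < δ * k / 20)).eventually_ge_atTop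
    (200000 * 2 ^ k * 2 ^ t)
  have ev2 := (hrpow (by linarith : 0 < 1 - δ / 2)).eventually_ge_atTop (1000 * (t + 2008))
  have ev3 := (hrpow (by linarith : 0 < δ / 2)).eventually_ge_atTop (1000 * (t * K))
  have ev4 : ∀ᶠ n : ℕ in atTop, δ * k / 20 * Real.log n ≤ 1 / 1000 * (n : ℝ) ^ (1 - δ / 2) := by
    have h := ((isLittleO_log_rpow_atTop (by linarith : 0 < 1 - δ / 2)).comp_tendsto
      tendsto_natCast_atTop_atTop).bound (c := 1 / 1000 / (δ * k / 20)) (by positivity)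
    filter_upwards [h, eventually_ge_atTop 1] with n hn hn1
    have hn1' : (1 : ℝ) ≤ n := by exact_mod_cast hn1
    simp only [Function.comp_apply, Real.norm_eq_abs] at hn
    rw [abs_of_nonneg (Real.log_nonneg hn1'), abs_of_nonneg (by positivity)] at hn
    calc δ * k / 20 * Real.log n
        ≤ δ * k / 20 * (1 / 1000 / (δ * k / 20) * (n : ℝ) ^ (1 - δ / 2)) := by gcongr
      _ = _ := by field_simp
  obtain ⟨N, hN⟩ := eventually_atTop.1 (ev1.and (ev2.and (ev3.and (ev4.and
    (eventually_ge_atTop 1)))))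
  refine ⟨N, fun n hn => ?_⟩
  obtain ⟨h1, h2, h3, h4, h5⟩ := hN n hn
  have hn1 : (1 : ℝ) ≤ n := by exact_mod_cast h5
  have hn0 : (0 : ℝ) < n := by linarith
  have ht0 : (0 : ℝ) ≤ t := Nat.cast_nonneg t
  have hRle := Nat.floor_le (by positivity : 0 ≤ (n : ℝ) ^ (1 - δ / 2))
  have hRlt := Nat.lt_floor_add_one ((n : ℝ) ^ (1 - δ / 2))
  have hc : δ / (20 * (t + 1)) * k * t ≤ δ * k / 20 := by
    rw [div_mul_eq_mul_div, div_mul_eq_mul_div, div_le_div_iff₀ (by positivity) (by norm_num)]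
    have : 0 ≤ δ * k := by positivity
    nlinarith
  refine ⟨⌊(n : ℝ) ^ (1 - δ / 2)⌋₊, Nat.floor_pos.2 (by linarith), ?_, ?_⟩
  · refine Nat.cast_le.1 (hRle.trans ?_)
    calc (n : ℝ) ^ (1 - δ / 2) ≤ (n : ℝ) ^ (1 : ℝ) :=
          Real.rpow_le_rpow_of_exponent_le hn1 (by linarith)
      _ = n := Real.rpow_one _
  intro s w hw hs
  set R := ⌊(n : ℝ) ^ (1 - δ / 2)⌋₊ with hR
  have hM1 : 1 ≤ (n : ℝ) ^ (δ / (20 * (t + 1)) * k) := Real.one_le_rpow hn1 (by positivity)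
  have hMt : ((n : ℝ) ^ (δ / (20 * (t + 1)) * k)) ^ t ≤ (n : ℝ) ^ (δ * k / 20) := by
    rw [← Real.rpow_mul_natCast hn0.le]
    exact Real.rpow_le_rpow_of_exponent_le hn1 hc
  constructor
  · have hs1 : ((s : ℝ) + 1) ^ t ≤ 2 ^ t * (n : ℝ) ^ (δ * k / 20) := by
      calc ((s : ℝ) + 1) ^ t ≤ (2 * (n : ℝ) ^ (δ / (20 * (t + 1)) * k)) ^ t := by
            gcongr; linarith
        _ ≤ _ := by rw [mul_pow]; gcongr
    have hRn : ((R : ℝ) / n) ^ ((k : ℝ) / 5) ≤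
        ((n : ℝ) ^ (δ * k / 20) * (n : ℝ) ^ (δ * k / 20))⁻¹ := by
      calc ((R : ℝ) / n) ^ ((k : ℝ) / 5) ≤ ((n : ℝ) ^ (-(δ / 2))) ^ ((k : ℝ) / 5) := by
            refine Real.rpow_le_rpow (by positivity) ?_ (by positivity)
            rw [div_le_iff₀ hn0]
            refine hRle.trans (le_of_eq ?_)
            nth_rewrite 3 [← Real.rpow_one (n : ℝ)]
            rw [← Real.rpow_add hn0]
            congr 1
            ring
        _ = _ := by
            rw [← Real.rpow_mul hn0.le, ← Real.rpow_add hn0, ← Real.rpow_neg hn0.le]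
            congr 1
            ring
    set y := (n : ℝ) ^ (δ * k / 20) with hy
    have hy0 : 0 < y := by positivity
    calc (2 * n : ℝ) ^ k * ((R : ℝ) / n) ^ ((k : ℝ) / 5)
        ≤ (2 * n : ℝ) ^ k * (y * y)⁻¹ := by gcongr
      _ = 2 ^ k * n ^ k / (y * y) := by rw [mul_pow]; rfl
      _ ≤ 1 / 1000 / 2 * (n : ℝ) ^ k / (2 ^ t * y) / 100 := by
          rw [div_div, div_le_div_iff₀ (by positivity) (by positivity)]
          have : (0 : ℝ) ≤ (n : ℝ) ^ k * y := by positivity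
          nlinarith [mul_le_mul_of_nonneg_left h1 this]
      _ ≤ _ := by gcongr
  · have hlog2 : Real.log 2 ≤ 1 := by linarith [Real.log_two_lt_d9]
    have hlog20 : 0 ≤ Real.log 2 := Real.log_nonneg (by norm_num)
    have hs2 : ((s : ℝ) * 2 ^ w + 1) ^ t ≤
        Real.exp (t + δ * k / 20 * Real.log n + t * K * (n : ℝ) ^ (1 - δ)) := by
      have e2 : ∀ j : ℕ, (2 : ℝ) ^ j ≤ Real.exp j := by
        intro j
        calc (2 : ℝ) ^ j ≤ Real.exp 1 ^ j := by
              gcongr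
              linarith [Real.add_one_le_exp (1 : ℝ)]
          _ = Real.exp j := by rw [← Real.exp_nat_mul, mul_one]
      calc ((s : ℝ) * 2 ^ w + 1) ^ t
          ≤ (2 * (n : ℝ) ^ (δ / (20 * (t + 1)) * k) * 2 ^ w) ^ t := by
            have hw1 : (1 : ℝ) ≤ 2 ^ w := one_le_pow₀ (by norm_num)
            gcongr
            nlinarith
        _ = 2 ^ t * ((n : ℝ) ^ (δ / (20 * (t + 1)) * k)) ^ t * 2 ^ (w * t) := by
            rw [mul_pow, mul_pow, ← pow_mul]
        _ ≤ Real.exp t * (n : ℝ) ^ (δ * k / 20) * Real.exp ((w * t : ℕ) : ℝ) := by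
            gcongr
            · exact e2 t
            · exact e2 (w * t)
        _ = Real.exp (t + δ * k / 20 * Real.log n + (w * t : ℕ)) := by
            rw [Real.exp_add, Real.exp_add, Real.rpow_def_of_pos hn0, mul_comm (Real.log _)]
        _ ≤ _ := by
            rw [Real.exp_le_exp]
            push_cast
            nlinarith
    have hρ : (993 / 1000 : ℝ) ^ R ≤ Real.exp (-(7 / 1000) * R) := by
      rw [mul_comm, Real.exp_nat_mul]
      refine pow_le_pow_left₀ (by norm_num) ?_ _
      linarith [Real.add_one_le_exp (-(7 / 1000) : ℝ)]
    have h3' : t * K * (n : ℝ) ^ (1 - δ) ≤ 1 / 1000 * (n : ℝ) ^ (1 - δ / 2) := by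
      have : (n : ℝ) ^ (1 - δ / 2) = (n : ℝ) ^ (1 - δ) * (n : ℝ) ^ (δ / 2) := by
        rw [← Real.rpow_add hn0]; congr 1; ring
      rw [this]
      have hp : 0 ≤ (n : ℝ) ^ (1 - δ) := by positivity
      nlinarith [mul_le_mul_of_nonneg_left h3 hp]
    calc ((s : ℝ) * 2 ^ w + 1) ^ t * (993 / 1000) ^ R
        ≤ Real.exp (t + δ * k / 20 * Real.log n + t * K * (n : ℝ) ^ (1 - δ)) *
            Real.exp (-(7 / 1000) * R) := by gcongr
      _ = Real.exp (t + δ * k / 20 * Real.log n + t * K * (n : ℝ) ^ (1 - δ) +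
            -(7 / 1000) * R) := by rw [← Real.exp_add]
      -- The exponent is at most `t - 5x/1000 + 7/1000` for `x = n^(1-δ/2)`.
      _ ≤ Real.exp (-2007) := by
          rw [Real.exp_le_exp]
          linarith
      _ < 1 / 1000 / 2 := by
          rw [Real.exp_neg]
          have : (2007 + 1 : ℝ) ≤ Real.exp 2007 := Real.add_one_le_exp _
          calc (Real.exp 2007)⁻¹ ≤ (2007 + 1 : ℝ)⁻¹ := inv_anti₀ (by norm_num) this
            _ < _ := by norm_num

end CellProbeANN

theorem theorem6p7 :
    ∃ C : ℝ, 0 < C ∧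
      ∀ (t : ℕ) (δ : ℝ), 0 < δ →
        ∃ c : ℝ, 0 < c ∧
          ∀ (ε K : ℝ), 0 < ε → 0 < K →
            ∃ N : ℕ, ∀ n : ℕ, N ≤ n →
              ∀ d : ℕ, C * max 1 (1 / ε ^ 2) * Real.log (n : ℝ) ≤ (d : ℝ) →
                ∃ L : ℕ, 1 ≤ L ∧ L ≤ d ∧
                  ∀ s w : ℕ, (w : ℝ) ≤ K * (n : ℝ) ^ (1 - δ) →
                    ∀ R : RandCellProbeScheme (PointSet d n) (Cube d) s w t,
                      R.Solves (annAcceptable ε L) →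
                        (n : ℝ) ^ (c / ε ^ 2) ≤ (s : ℝ) := by
  classical
  refine ⟨12288, by norm_num, fun t δ hδ => ?_⟩
  have hδ' : 0 < min δ 1 := lt_min hδ one_pos
  refine ⟨min δ 1 / (20 * (t + 1)) / 128, by positivity, fun ε K hε hK => ?_⟩
  obtain ⟨k, hk, hkε, N₁, hN₁⟩ := CellProbeANN.exists_gap_embedding ε hε
  obtain ⟨N₂, hN₂⟩ := CellProbeANN.exists_contradictory_parameters k t hk hδ' (K := K)
    (min_le_right δ 1)
  refine ⟨max 1 (max N₁ N₂), fun n hn d hd => ?_⟩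
  obtain ⟨hn1, hn'⟩ := max_le_iff.1 hn
  obtain ⟨hnN₁, hnN₂⟩ := max_le_iff.1 hn'
  have hn1' : (1 : ℝ) ≤ n := by exact_mod_cast hn1
  obtain ⟨L, hL1, hLd, r, hr, hbad⟩ := hN₁ n hnN₁ d hd
  obtain ⟨R, hR, hRn, hpar⟩ := hN₂ n hnN₂
  refine ⟨L, hL1, hLd, fun s w hw S hS => ?_⟩
  by_contra hcon
  push Not at hcon
  have hs : (s : ℝ) ≤ (n : ℝ) ^ (min δ 1 / (20 * (t + 1)) * k) := by
    refine hcon.le.trans (Real.rpow_le_rpow_of_exponent_le hn1' ?_)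
    calc min δ 1 / (20 * (t + 1)) / 128 / ε ^ 2
        = min δ 1 / (20 * (t + 1)) * (1 / (128 * ε ^ 2)) := by field_simp
      _ ≤ _ := by gcongr
  have hw' : (w : ℝ) ≤ K * (n : ℝ) ^ (1 - min δ 1) := by
    refine hw.trans ?_
    gcongr
    exact min_le_left δ 1
  obtain ⟨hsmall, hlt⟩ := hpar s w hw' hs
  obtain ⟨enc, alg, ht, hsum⟩ := CellProbeANN.exists_deterministic hk r hr
    (hbad _ fun σ hσ => (Finset.mem_filter.1 hσ).2) S hS
  have hge := CellProbeANN.le_transcripts_mul_pow hk hR hRn (by norm_num) enc alg ht hsum hsmall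
  linarith
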